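/- **Theorem 1 (Non-Gibbsianness for large $p$).** Let $d\ge 2$ and let $\Omega=\{0,1\}^{\mathbb Z^d}$ carry the product topology and its Borel $\sigma$-algebra. For $p\in[0,1]$ let $\mu_p$ be the law on $\Omega$ under which the coordinates are i.i.d. Bernoulli($p$). Let $T:\Omega\to\Omega$ be the map that deletes every occupied site without occupied nearest neighbour, that is, $$(T\omega)_x=\omega_x\Bigl(1-\prod_{y:\,|x-y|_1=1}(1-\omega_y)\Bigr),\qquad x\in\mathbb Z^d,$$ and let $\mu'_p=\mu_p\circ T^{-1}$. A *specification* is a family $\gamma=(\gamma_\Lambda)$ of probability kernels $\gamma_\Lambda(\cdot\,|\,\cdot)$ on $\Omega$, indexed by the finite sets $\Lambda\subset\mathbb Z^d$, such that for each $\Lambda$ * for every measurable $A\subset\Omega$, $\omega\mapsto\gamma_\Lambda(A|\omega)$ is measurable with respect to the $\sigma$-algebra generated by the coordinates outside $\Lambda$; * (properness) $\gamma_\Lambda(\{\eta:\eta_{\Lambda^c}=\omega_{\Lambda^c}\}\,|\,\omega)=1$ for every $\omega\in\Omega$; * (consistency) $\int\gamma_\Delta(d\eta|\omega)\,\gamma_\Lambda(A|\eta)=\gamma_\Delta(A|\omega)$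 for every finite $\Delta\supseteq\Lambda$, every $\omega\in\Omega$ and every measurable $A\subset\Omega$. It is *quasilocal* if for every finite $\Lambda$ and every $\sigma\in\{0,1\}^\Lambda$ the function $\omega\mapsto\gamma_\Lambda(\{\eta:\eta_\Lambda=\sigma\}\,|\,\omega)$ is continuous on $\Omega$. It is a specification *for* a probability measure $\mu$ on $\Omega$ if $\int\mu(d\omega)\,\gamma_\Lambda(A|\omega)=\mu(A)$ for every finite $\Lambda$ and every measurable $A\subset\Omega$. Then there is $p_c(d)<1$, with $p_c(d)\in[0,1)$, such that for every $p\in(p_c(d),1)$ there is no quasilocal specification for $\mu'_p$. -/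

import Mathlib

open MeasureTheory ProbabilityTheory

/-- The sites of the lattice `ℤ^d`. -/
abbrev Site (d : ℕ) : Type := Fin d → ℤ

/-- Configurations in `{0,1}^(ℤ^d)`; `true` means occupied. The type carries the product topology
and the product (Borel) sigma-algebra of the discrete two-point space. -/
abbrev Config (d : ℕ) : Type := Site d → Bool

/-- Nearest neighbours in `ℤ^d`: sites at `ℓ¹`-distance one. -/
def IsNeighbor {d : ℕ} (x y : Site d) : Prop := ∑ i, |x i - y i| = 1

open Classical in
/-- The projection to the non-isolates: a site is occupied in the image iff it is occupied and at
least one of its nearest neighbours is occupied. -/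
noncomputable def removeIsolated {d : ℕ} (ω : Config d) : Config d :=
  fun x => ω x && decide (∃ y, IsNeighbor x y ∧ ω y = true)

/-- Measurability of the map, so that its push-forward below is the genuine image measure. -/
theorem measurable_removeIsolated (d : ℕ) : Measurable (removeIsolated (d := d)) := by
  refine measurable_pi_lambda _ fun x => ?_
  have h : MeasurableSet {ω : Config d | ∃ y, IsNeighbor x y ∧ ω y = true} := by
    have : {ω : Config d | ∃ y, IsNeighbor x y ∧ ω y = true} =
        ⋃ y : Site d, ⋃ _ : IsNeighbor x y, (fun ω : Config d => ω y) ⁻¹' {true} := by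
      ext ω
      simp
    rw [this]
    exact MeasurableSet.iUnion fun y => MeasurableSet.iUnion fun _ =>
      measurable_pi_apply y (measurableSet_singleton true)
  refine measurable_to_bool ?_
  have e : (fun ω : Config d => removeIsolated ω x) ⁻¹' {true} =
      (fun ω : Config d => ω x) ⁻¹' {true} ∩ {ω : Config d | ∃ y, IsNeighbor x y ∧ ω y = true} := by
    ext ω
    simp [removeIsolated]
  rw [e]
  exact (measurable_pi_apply x (measurableSet_singleton true)).inter h

/-- The i.i.d. Bernoulli field on `ℤ^d` with occupation probability `p`. -/
noncomputable def bernoulliField (d : ℕ) (p : unitInterval) : Measure (Config d) :=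
  Measure.infinitePi fun _ : Site d => bernoulliMeasure true false p

/-- The image of the Bernoulli field under the projection to the non-isolates. -/
noncomputable def thinnedField (d : ℕ) (p : unitInterval) : Measure (Config d) :=
  (bernoulliField d p).map removeIsolated

/-- A specification on `{0,1}^(ℤ^d)`: a family of probability kernels, indexed by the finite
volumes `Λ`, where `kernel Λ ω` is the conditional distribution given `ω` outside `Λ` (it depends
measurably on `ω` through the coordinates outside `Λ` only), which is proper and consistent. -/
structure Specification (d : ℕ) where
  /-- The kernel of a finite volume. -/
  kernel (Λ : Finset (Site d)) :
    @Kernel (Config d) (Config d) (cylinderEvents ((Λ : Set (Site d))ᶜ)) MeasurableSpace.pi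
  /-- Every kernel has total mass one. -/
  markov : ∀ Λ ω, IsProbabilityMeasure (kernel Λ ω)
  /-- Properness: outside `Λ` the boundary condition is kept. -/
  proper : ∀ Λ ω, kernel Λ ω {η | ∀ x, x ∉ Λ → η x = ω x} = 1
  /-- Consistency: `γ_Δ γ_Λ = γ_Δ` for `Λ ⊆ Δ`. -/
  consistent : ∀ Λ Δ : Finset (Site d), Λ ⊆ Δ → ∀ ω (A : Set (Config d)), MeasurableSet A →
    ∫⁻ η, kernel Λ η A ∂(kernel Δ ω) = kernel Δ ω A

/-- A specification is quasilocal if, for each finite volume and each pattern `σ` there, the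
probability of seeing `σ` is a continuous function of the boundary condition in the product
topology. -/
def Specification.IsQuasilocal {d : ℕ} (γ : Specification d) : Prop :=
  ∀ (Λ : Finset (Site d)) (σ : Λ → Bool),
    Continuous fun ω : Config d => γ.kernel Λ ω {η | ∀ x : Λ, η x = σ x}

/-- `γ` is a specification for `μ`: the DLR equations `μ γ_Λ = μ` hold. -/
def Specification.IsSpecificationFor {d : ℕ} (γ : Specification d) (μ : Measure (Config d)) :
    Prop :=
  ∀ (Λ : Finset (Site d)) (A : Set (Config d)), MeasurableSet A →
    ∫⁻ ω, γ.kernel Λ ω A ∂μ = μ A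

/-! Put `a = p / (1 - p)` and let `Λ = cross d`. Condition the image field on being vacant in a
large volume `V` around `Λ`, except on `Λ` itself, and occupied on a suitable set `S` beyond it.
Since every site of the layer around `V` has a neighbour in `S`, vacancy of that layer in the image
forces vacancy in the original field, and the original occupied set in `V` can have neighbouring
pairs only through the origin. Summing out the origin leaves the hard-core model of activity `a` on
`V.erase 0` (`exists_conditioning`). In the image `Λ` is vacant unless the origin and one of its
neighbours were occupied, so its conditional probability is `1 - a / (1 + a) * r`, where `r` is the
hard-core probability of finding a particle next to the origin.

At large `a` the hard-core model orders on one of the two sublattices, and the shape of `V` selects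
which: `phaseBox P N` omits the sites of the wrong colour at the edge of the box. If the sublattice
of the origin is favoured, `r` is at most `1/16` (`activeWeight_le`); if the other one is, `r` is at
least `7/8` (`le_activeWeight`). A quasilocal specification would make the two conditional
probabilities nearly equal, because both conditionings are vacant on the same large box off `Λ`
(`Specification.IsQuasilocal.exists_box`). This is the contradiction.

The ordering is a Peierls argument (`peierls`). A particle of the wrong colour at `v` is enclosed by
a region `A` whose boundary edges carry no particles and all have inner ends of the favoured colour
(`exists_isContour`). Shifting the particles in `A` by a unit vector `e` frees the sites of `front A
e`; filling these gains a factor `a` per site and is injective for given `A` and `e`. For the best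
`e` the front has size at least `(bdry A).card / (4 * d)`. The boundary determines `A` and is
connected (`eq_of_bdry_eq`, `isConn_bdry`), so there are only exponentially many boundaries of each
size, and large `a` wins. -/

/-! ### Neighbours, colourings and induction on the lattice. -/

/-- The `2d` signed unit vectors of `ℤ^d`. -/
def dirVec {d : ℕ} (e : Fin d × Bool) : Site d := Pi.single e.1 (if e.2 then 1 else -1)

theorem dirVec_not {d : ℕ} (i : Fin d) (b : Bool) : dirVec (i, !b) = -dirVec (i, b) := by
  cases b <;> simp [dirVec, Pi.single_neg]

theorem isNeighbor_iff {d : ℕ} {x y : Site d} : IsNeighbor x y ↔ ∃ e, y = x + dirVec e := by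
  constructor
  · intro h
    unfold IsNeighbor at h
    obtain ⟨i, hi⟩ : ∃ i, |x i - y i| ≠ 0 := by
      by_contra! hc
      simp [hc] at h
    have h1 := Finset.add_sum_erase Finset.univ (fun i => |x i - y i|) (Finset.mem_univ i)
    have h2 : 0 ≤ ∑ j ∈ Finset.univ.erase i, |x j - y j| :=
      Finset.sum_nonneg fun j _ => abs_nonneg _
    have h3 : 1 ≤ |x i - y i| := Int.one_le_abs (by simpa using hi)
    have h4 : ∑ j ∈ Finset.univ.erase i, |x j - y j| = 0 := by omega
    have h5 : |x i - y i| = 1 := by omega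
    rw [Finset.sum_eq_zero_iff_of_nonneg fun j _ => abs_nonneg _] at h4
    have h6 : ∀ j, j ≠ i → y j = x j := fun j hj => by
      have := h4 j (by simp [hj])
      rw [abs_eq_zero] at this
      omega
    rcases abs_eq (by norm_num : (0 : ℤ) ≤ 1) |>.1 h5 with h | h
    · refine ⟨(i, false), funext fun j => ?_⟩
      by_cases hj : j = i
      · subst hj; simp [dirVec]; omega
      · simp [dirVec, hj, h6 j hj]
    · refine ⟨(i, true), funext fun j => ?_⟩
      by_cases hj : j = i
      · subst hj; simp [dirVec]; omega
      · simp [dirVec, hj, h6 j hj]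
  · rintro ⟨⟨i, b⟩, rfl⟩
    unfold IsNeighbor
    rw [Finset.sum_eq_single i]
    · cases b <;> simp [dirVec]
    · intro j _ hj
      simp [dirVec, hj]
    · simp

theorem isNeighbor_add_dirVec {d : ℕ} (x : Site d) (e : Fin d × Bool) :
    IsNeighbor x (x + dirVec e) := isNeighbor_iff.2 ⟨e, rfl⟩

theorem IsNeighbor.symm {d : ℕ} {x y : Site d} (h : IsNeighbor x y) : IsNeighbor y x := by
  unfold IsNeighbor at *
  simpa only [abs_sub_comm] using h

theorem isNeighbor_add_right {d : ℕ} {x y : Site d} (z : Site d) :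
    IsNeighbor (x + z) (y + z) ↔ IsNeighbor x y := by
  simp [IsNeighbor]

theorem IsNeighbor.even_iff {d : ℕ} {x y : Site d} (h : IsNeighbor x y) :
    Even (∑ i, x i) ↔ ¬ Even (∑ i, y i) := by
  obtain ⟨⟨i, b⟩, rfl⟩ := isNeighbor_iff.1 h
  have : ∑ j, (x + dirVec (i, b)) j = ∑ j, x j + (if b then 1 else -1) := by
    simp [dirVec, Finset.sum_add_distrib]
  rw [this]
  cases b <;> simp [Int.even_add]

/-- A colouring of the sites in which neighbours have different colours. -/
def IsParity {d : ℕ} (P : Site d → Prop) : Prop := ∀ x y, IsNeighbor x y → (P x ↔ ¬ P y)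

/-- The neighbours of a site. -/
def nbrs {d : ℕ} (x : Site d) : Finset (Site d) :=
  Finset.univ.image fun e : Fin d × Bool => x + dirVec e

@[simp] theorem mem_nbrs {d : ℕ} {x y : Site d} : y ∈ nbrs x ↔ IsNeighbor x y := by
  simp only [nbrs, Finset.mem_image, Finset.mem_univ, true_and, isNeighbor_iff, eq_comm]

theorem card_nbrs_le {d : ℕ} (x : Site d) : (nbrs x).card ≤ 2 * d := by
  refine Finset.card_image_le.trans ?_
  simp [mul_comm]

theorem forall_add_single {d : ℕ} {Q : Site d → Prop} (i : Fin d)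
    (step : ∀ x n, Q x → n = 1 ∨ n = -1 → Q (x + Pi.single i n)) (x : Site d) (hx : Q x) (n : ℤ) :
    Q (x + Pi.single i n) := by
  induction n using Int.induction_on with
  | zero => simpa using hx
  | succ n ih =>
    rw [Pi.single_add, ← add_assoc]
    exact step _ _ ih (Or.inl rfl)
  | pred n ih =>
    rw [sub_eq_add_neg, Pi.single_add, ← add_assoc]
    exact step _ _ ih (Or.inr rfl)

theorem isNeighbor_add_single {d : ℕ} (x : Site d) (i : Fin d) {n : ℤ} (hn : n = 1 ∨ n = -1) :
    IsNeighbor x (x + Pi.single i n) := by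
  rcases hn with rfl | rfl
  · exact isNeighbor_add_dirVec x (i, true)
  · exact isNeighbor_add_dirVec x (i, false)

theorem lattice_induction {d : ℕ} {Q : Site d → Prop}
    (step : ∀ x y, IsNeighbor x y → Q x → Q y) {v : Site d} (hv : Q v) (y : Site d) : Q y := by
  have key : ∀ s : Finset (Fin d), Q (v + ∑ i ∈ s, Pi.single i (y i - v i)) := by
    intro s
    induction s using Finset.induction_on with
    | empty => simpa using hv
    | insert k s hk ih =>
      rw [Finset.sum_insert hk, add_comm (Pi.single _ _), ← add_assoc]
      exact forall_add_single k (fun x n hx hn => step _ _ (isNeighbor_add_single x k hn) hx) _ ih _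
  have h := key Finset.univ
  rw [Finset.univ_sum_single (fun i => y i - v i)] at h
  convert h using 1
  funext i
  simp

/-! ### Exactness of closed cochains. -/

theorem exists_primitive {G : Type*} [AddCommGroup G] (h : ℤ → G) :
    ∃ H : ℤ → G, H 0 = 0 ∧ ∀ n, H (n + 1) = H n + h n := by
  refine ⟨fun n => ∑ t ∈ Finset.Ico 0 n, h t - ∑ t ∈ Finset.Ico n 0, h t, by simp, fun n => ?_⟩
  rcases le_or_gt 0 n with hn | hn
  · have e1 : Finset.Ico 0 (n + 1) = insert n (Finset.Ico 0 n) := by ext; simp; omega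
    have e2 : Finset.Ico (n + 1) 0 = ∅ := by ext; simp; omega
    have e3 : Finset.Ico n 0 = ∅ := by ext; simp; omega
    simp only [e1, e2, e3]
    rw [Finset.sum_insert (by simp)]
    simp [add_comm]
  · have e1 : Finset.Ico n 0 = insert n (Finset.Ico (n + 1) 0) := by ext; simp; omega
    have e2 : Finset.Ico 0 (n + 1) = ∅ := by ext; simp; omega
    have e3 : Finset.Ico 0 n = ∅ := by ext; simp; omega
    simp only [e1, e2, e3]
    rw [Finset.sum_insert (by simp)]
    simp

theorem eq_zero_of_add_one {G : Type*} {φ : ℤ → G} (h : ∀ n, φ (n + 1) = φ n) (n : ℤ) :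
    φ n = φ 0 := by
  induction n using Int.induction_on with
  | zero => rfl
  | succ n ih => rw [h, ih]
  | pred n ih => rw [← ih, ← h (-n - 1)]; simp

/-- Closed cochains on `ℤ^d` are exact. -/
theorem exists_potential {d : ℕ} {G : Type*} [AddCommGroup G] (u : Fin d → Site d → G)
    (hu : ∀ i j x, u i x + u j (x + Pi.single i 1) = u j x + u i (x + Pi.single j 1)) :
    ∃ g : Site d → G, ∀ i x, g (x + Pi.single i 1) = g x + u i x := by
  have key : ∀ s : Finset (Fin d), ∃ g : Site d → G, ∀ i ∈ s, ∀ x,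
      g (x + Pi.single i 1) = g x + u i x := by
    intro s
    induction s using Finset.induction_on with
    | empty => exact ⟨0, by simp⟩
    | insert k s hk ih =>
      obtain ⟨g, hg⟩ := ih
      choose H H0 H1 using fun h : ℤ → G => exists_primitive h
      -- Keep `g` on the hyperplane where coordinate `k` vanishes and integrate `u k` away from it.
      -- Closedness on the squares spanned by `i` and `k` carries the increments in the earlier
      -- directions `i` off the hyperplane.
      refine ⟨fun x => g (Function.update x k 0) + H (fun t => u k (Function.update x k t)) (x k),
        fun i hi x => ?_⟩
      by_cases hik : i = k
      · subst hik
        have e : ∀ t, Function.update (x + Pi.single i 1) i t = Function.update x i t := by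
          intro t; ext j; by_cases hj : j = i
          · subst hj; simp
          · simp [hj]
        simp only [e, Pi.add_apply, Pi.single_eq_same, H1, Function.update_eq_self, add_assoc]
      · have his : i ∈ s := by simpa [hik] using hi
        have e : ∀ t, Function.update (x + Pi.single i 1) k t =
            Function.update x k t + Pi.single i 1 := by
          intro t; ext j; by_cases hj : j = k
          · subst hj; simp [Ne.symm hik]
          · simp [hj]
        have e' : ∀ t, Function.update x k (t + 1) = Function.update x k t + Pi.single k 1 := by
          intro t; ext j; by_cases hj : j = k
          · subst hj; simp
          · simp [hj]
        have c := eq_zero_of_add_one (φ := fun n =>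
          H (fun t => u k (Function.update x k t + Pi.single i 1)) n + u i (Function.update x k 0)
            - u i (Function.update x k n) - H (fun t => u k (Function.update x k t)) n)
          (fun n => by
            have := hu k i (Function.update x k n)
            rw [← e'] at this
            simp only [H1]
            have h2 : u k (Function.update x k n + Pi.single i 1) =
              u k (Function.update x k n) + u i (Function.update x k (n + 1))
                - u i (Function.update x k n) := by
              rw [this]; abel
            rw [h2]; abel) (x k)
        simp only [H0, Function.update_eq_self] at c
        simp only [e, hg i his, Pi.add_apply, Pi.single_eq_of_ne (Ne.symm hik), add_zero]
        have c' : H (fun t => u k (Function.update x k t + Pi.single i 1)) (x k)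
            + u i (Function.update x k 0) = u i x + H (fun t => u k (Function.update x k t)) (x k) := by
          rw [← sub_eq_zero, ← sub_sub, c]; abel
        rw [add_assoc, add_comm (u i _), c']; abel
  obtain ⟨g, hg⟩ := key Finset.univ
  exact ⟨g, fun i x => hg i (Finset.mem_univ i) x⟩

/-! ### Boxes and connectedness of their complements. -/

/-- The box `[-N, N]^d`. -/
noncomputable def box (d N : ℕ) : Finset (Site d) := Fintype.piFinset fun _ => Finset.Icc (-(N : ℤ)) N

theorem mem_box {d N : ℕ} {x : Site d} : x ∈ box d N ↔ ∀ i, |x i| ≤ N := by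
  simp [box, abs_le]

/-- While one coordinate exceeds `N` in absolute value, all others can be moved freely without
entering the box. From the corner point, first set a large coordinate of `y`, shielded by a second
one (here `2 ≤ d` enters), then set the others. -/
theorem box_compl_induction {d : ℕ} (hd : 2 ≤ d) (N : ℕ) {Q : Site d → Prop}
    (step : ∀ x y, IsNeighbor x y → y ∉ box d N → Q x → Q y) (hq : Q fun _ => (N : ℤ) + 1)
    {y : Site d} (hy : y ∉ box d N) : Q y := by
  have A : ∀ (z : Site d) (i j : Fin d) (t : ℤ), Q z → (N : ℤ) < |z j| → j ≠ i →
      Q (Function.update z i t) := by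
    intro z i j t hz hj hji
    have := forall_add_single (Q := fun w => Q w ∧ w j = z j) i (fun x n hx hn => by
      have e : (x + Pi.single i n : Site d) j = z j := by simp [hji, hx.2]
      refine ⟨step _ _ (isNeighbor_add_single x i hn) (fun hb => ?_) hx.1, e⟩
      have := mem_box.1 hb j
      rw [e] at this
      omega) z ⟨hz, rfl⟩ (t - z i)
    convert this.1 using 1
    ext k
    by_cases hk : k = i
    · subst hk; simp
    · simp [hk]
  have B : ∀ (z : Site d) (j : Fin d), Q z → (N : ℤ) < |z j| → y j = z j → Q y := by
    intro z j hz hj hyj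
    have : ∀ s : Finset (Fin d), j ∉ s → Q (s.piecewise y z) := by
      intro s
      induction s using Finset.induction_on with
      | empty => simpa using hz
      | insert k s hk ih =>
        intro hjs
        rw [Finset.mem_insert, not_or] at hjs
        rw [Finset.piecewise_insert]
        refine A _ k j _ (ih hjs.2) ?_ hjs.1
        rwa [Finset.piecewise_eq_of_notMem _ _ _ hjs.2]
    convert this (Finset.univ.erase j) (by simp) using 1
    ext k
    by_cases hk : k = j
    · subst hk; simp [hyj]
    · simp [Finset.piecewise, hk]
  rw [mem_box] at hy
  push Not at hy
  obtain ⟨i, hi⟩ := hy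
  obtain ⟨j, hj⟩ : ∃ j : Fin d, j ≠ i := by
    have : Nontrivial (Fin d) := Fin.nontrivial_iff_two_le.2 hd
    exact exists_ne i
  refine B (Function.update (fun _ => (N : ℤ) + 1) i (y i)) i (A _ i j _ hq ?_ hj) ?_ ?_
  · have := le_abs_self ((N : ℤ) + 1)
    omega
  · simpa using hi
  · simp

/-! ### Boundaries of regions: they determine the region and are connected. -/

/-- A set of sites is connected if every predicate that is constant along its edges is constant. -/
def IsConn {d : ℕ} (S : Set (Site d)) : Prop :=
  ∀ f : Site d → Prop, (∀ x ∈ S, ∀ y ∈ S, IsNeighbor x y → (f x ↔ f y)) →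
    ∀ x ∈ S, ∀ y ∈ S, (f x ↔ f y)

open Classical in
/-- The sites that lie on an edge between `A` and its complement. -/
noncomputable def bdry {d : ℕ} (A : Finset (Site d)) : Finset (Site d) :=
  (A.filter fun x => ∃ y, IsNeighbor x y ∧ y ∉ A) ∪ (A.biUnion nbrs \ A)

theorem mem_bdry {d : ℕ} {A : Finset (Site d)} {x : Site d} :
    x ∈ bdry A ↔ ∃ y, IsNeighbor x y ∧ ¬ (x ∈ A ↔ y ∈ A) := by
  classical
  simp only [bdry, Finset.mem_union, Finset.mem_filter, Finset.mem_sdiff, Finset.mem_biUnion,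
    mem_nbrs]
  constructor
  · rintro (⟨h, y, h1, h2⟩ | ⟨⟨y, h1, h2⟩, h⟩)
    · exact ⟨y, h1, by tauto⟩
    · exact ⟨y, h2.symm, by tauto⟩
  · rintro ⟨y, h1, h2⟩
    by_cases hx : x ∈ A
    · exact Or.inl ⟨hx, y, h1, by tauto⟩
    · exact Or.inr ⟨⟨y, by tauto, h1.symm⟩, hx⟩

/-- The inner end points of the boundary edges of `A` have colour `P`. -/
def HasInnerColour {d : ℕ} (P : Site d → Prop) (A : Finset (Site d)) : Prop :=
  ∀ x ∈ A, ∀ y, y ∉ A → IsNeighbor x y → P x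

theorem HasInnerColour.mem_iff {d : ℕ} {P : Site d → Prop} (hP : IsParity P) {A : Finset (Site d)}
    (hA : HasInnerColour P A) {x : Site d} (hx : x ∈ bdry A) : x ∈ A ↔ P x := by
  obtain ⟨y, h1, h2⟩ := mem_bdry.1 hx
  have h3 := hP x y h1
  constructor
  · intro h
    exact hA x h y (by tauto) h1
  · intro h
    by_contra hc
    have := hA y (by tauto) x hc h1.symm
    tauto

/-- On the boundary, membership is read off from the colour; at any other site it agrees with that
of every neighbour. So agreement spreads from `v` over the lattice. -/
theorem eq_of_bdry_eq {d : ℕ} {P : Site d → Prop} (hP : IsParity P) {A B : Finset (Site d)}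
    (hA : HasInnerColour P A) (hB : HasInnerColour P B) (h : bdry A = bdry B) {v : Site d}
    (hvA : v ∈ A) (hvB : v ∈ B) : A = B := by
  ext y
  refine lattice_induction (Q := fun y => y ∈ A ↔ y ∈ B) (fun x y hxy hx => ?_)
    (by simp [hvA, hvB] : v ∈ A ↔ v ∈ B) y
  by_cases hy : y ∈ bdry A
  · rw [hA.mem_iff hP hy, hB.mem_iff hP (h ▸ hy)]
  · have h1 := hy
    rw [h] at h1
    rw [mem_bdry] at hy h1
    push Not at hy h1
    have := hy x hxy.symm
    have := h1 x hxy.symm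
    tauto

-- Closedness on a unit square, by cases. `a b c e` record membership at the corners, `p q r t` the
-- labels, `s` the colour of the first corner. The colour conditions exclude two cut edges on
-- opposite sides only, so the cut edges of a square are linked through common corners and share one
-- label; their number is even.
set_option synthInstance.maxHeartbeats 400000 in
set_option synthInstance.maxSize 10000 in
set_option maxRecDepth 10000 in
theorem square_parity : ∀ a b c e p q r t s : Bool,
    (s = true → (b = true → a = true) ∧ (c = true → a = true) ∧ (b = true → e = true) ∧
      (c = true → e = true)) →
    (s = false → (a = true → b = true) ∧ (a = true → c = true) ∧ (e = true → b = true) ∧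
      (e = true → c = true)) →
    (a ≠ b → p = q) → (a ≠ c → p = r) → (b ≠ e → q = t) → (c ≠ e → r = t) →
    ((if (a != b) && p then 1 else 0) + (if (b != e) && q then 1 else 0) : ZMod 2) =
      (if (a != c) && p then 1 else 0) + (if (c != e) && r then 1 else 0) := by
  decide

/-- The boundary of a connected set with connected complement is connected. -/
theorem isConn_bdry {d : ℕ} {P : Site d → Prop} (hP : IsParity P) {A : Finset (Site d)}
    (hA : HasInnerColour P A) (h1 : IsConn (A : Set (Site d))) (h2 : IsConn (A : Set (Site d))ᶜ) :
    IsConn (bdry A : Set (Site d)) := by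
  classical
  intro f hf
  -- The cochain that marks the boundary edges labelled by `f`. A potential `g` for it is constant
  -- on `A` and on its complement, hence has the same jump across every boundary edge, so `f` takes
  -- a single value.
  let c : Site d → Site d → ZMod 2 := fun x y =>
    if (decide (x ∈ A) != decide (y ∈ A)) && decide (f x) then 1 else 0
  have hbd : ∀ x y, IsNeighbor x y → ¬ (x ∈ A ↔ y ∈ A) → (f x ↔ f y) := fun x y h h' =>
    hf x (mem_bdry.2 ⟨y, h, h'⟩) y (mem_bdry.2 ⟨x, h.symm, by tauto⟩) h
  have csymm : ∀ x y, IsNeighbor x y → c x y = c y x := by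
    intro x y h
    have := hbd x y h
    simp only [c]
    by_cases hx : x ∈ A <;> by_cases hy : y ∈ A <;> simp_all
  have sq : ∀ x y z w, IsNeighbor x y → IsNeighbor x z → IsNeighbor y w → IsNeighbor z w →
      c x y + c y w = c x z + c z w := by
    intro x y z w hxy hxz hyw hzw
    have p1 := hP _ _ hxy
    have p2 := hP _ _ hxz
    have p3 := hP _ _ hyw
    have p4 := hP _ _ hzw
    have a1 := fun h h' => hA x h y h' hxy
    have a2 := fun h h' => hA x h z h' hxz
    have a3 := fun h h' => hA y h w h' hyw
    have a4 := fun h h' => hA z h w h' hzw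
    have a1' := fun h h' => hA y h x h' hxy.symm
    have a2' := fun h h' => hA z h x h' hxz.symm
    have a3' := fun h h' => hA w h y h' hyw.symm
    have a4' := fun h h' => hA w h z h' hzw.symm
    refine square_parity _ _ _ _ (decide (f x)) (decide (f y)) (decide (f z)) (decide (f w))
      (decide (P x)) ?_ ?_ ?_ ?_ ?_ ?_
    · simp only [decide_eq_true_eq]
      exact fun h => ⟨fun hy => by_contra fun hx => p1.1 h (a1' hy hx),
        fun hz => by_contra fun hx => p2.1 h (a2' hz hx),
        fun hy => by_contra fun hw => p1.1 h (a3 hy hw),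
        fun hz => by_contra fun hw => p2.1 h (a4 hz hw)⟩
    · simp only [decide_eq_false_iff_not, decide_eq_true_eq]
      exact fun h => ⟨fun hx => by_contra fun hy => h (a1 hx hy),
        fun hx => by_contra fun hz => h (a2 hx hz),
        fun hw => by_contra fun hy => p3.1 (not_not.1 (mt p1.2 h)) (a3' hw hy),
        fun hw => by_contra fun hz => p4.1 (not_not.1 (mt p2.2 h)) (a4' hw hz)⟩
    · intro h; simpa using hbd x y hxy (by simpa using h)
    · intro h; simpa using hbd x z hxz (by simpa using h)
    · intro h; simpa using hbd y w hyw (by simpa using h)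
    · intro h; simpa using hbd z w hzw (by simpa using h)
  obtain ⟨g, hg⟩ := exists_potential (fun i x => c x (x + Pi.single i 1)) (fun i j x => by
    refine sq _ _ _ _ (isNeighbor_add_single x i (Or.inl rfl))
      (isNeighbor_add_single x j (Or.inl rfl)) (isNeighbor_add_single _ j (Or.inl rfl)) ?_ |>.trans ?_
    · rw [add_right_comm]; exact isNeighbor_add_single _ i (Or.inl rfl)
    · rw [add_right_comm])
  have hg' : ∀ x y, IsNeighbor x y → g y = g x + c x y := by
    intro x y h
    obtain ⟨⟨i, b⟩, rfl⟩ := isNeighbor_iff.1 h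
    cases b
    · have h3 := hg i (x + dirVec (i, false))
      have e : x + dirVec (i, false) + Pi.single i 1 = x := by
        ext j; by_cases hj : j = i
        · subst hj; simp [dirVec]
        · simp [dirVec, hj]
      rw [e] at h3
      rw [csymm _ _ h, h3, add_assoc, CharTwo.add_self_eq_zero, add_zero]
    · exact hg i x
  have const : ∀ S : Set (Site d), IsConn S → (∀ x ∈ S, ∀ y ∈ S, (x ∈ A ↔ y ∈ A)) →
      ∀ x ∈ S, ∀ y ∈ S, g x = g y := by
    intro S hS hSA x hx y hy
    refine ((hS (fun z => g z = g y) (fun a ha b hb hab => ?_) x hx y hy).2 rfl)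
    have : c a b = 0 := by simp [c, hSA a ha b hb]
    rw [hg' a b hab, this, add_zero]
  have hin := const _ h1 (by simp; tauto)
  have hout := const _ h2 (by simp; tauto)
  have inner : ∀ x ∈ bdry A, ∃ a ∈ A, ∃ b, b ∉ A ∧ IsNeighbor a b ∧ (f x ↔ f a) := by
    intro x hx
    obtain ⟨y, hxy, h⟩ := mem_bdry.1 hx
    by_cases hxA : x ∈ A
    · exact ⟨x, hxA, y, by tauto, hxy, Iff.rfl⟩
    · exact ⟨y, by tauto, x, hxA, hxy.symm, hbd _ _ hxy h⟩
  intro x hx y hy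
  obtain ⟨a, ha, b, hb, hab, hxa⟩ := inner x hx
  obtain ⟨a', ha', b', hb', hab', hya⟩ := inner y hy
  have e1 := hg' a b hab
  have e2 := hg' a' b' hab'
  rw [hout b (by simpa using hb) b' (by simpa using hb'), e2,
    hin a' (by simpa using ha') a (by simpa using ha)] at e1
  have e3 := add_left_cancel e1
  simp only [c, ha, hb, ha', hb'] at e3
  rw [hxa, hya]
  by_cases f1 : f a <;> by_cases f2 : f a' <;> simp_all

/-! ### Counting connected sets by covering walks. -/

/-- The sites visited by the walk that starts at `r` and takes the steps `l`. -/
def walkSites {d : ℕ} : Site d → List (Fin d × Bool) → Finset (Site d)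
  | r, [] => {r}
  | r, e :: l => insert r (walkSites (r + dirVec e) l)

theorem start_mem_walkSites {d : ℕ} (r : Site d) (l : List (Fin d × Bool)) :
    r ∈ walkSites r l := by
  cases l <;> simp [walkSites]

/-- When the walk is at `t`, insert the detour of stepping along `e` and back. Each new site of a
connected set thus costs two steps. -/
theorem exists_walkSites_insert {d : ℕ} (e : Fin d × Bool) (t : Site d)
    (l : List (Fin d × Bool)) : ∀ r, t ∈ walkSites r l →
    ∃ l', l'.length = l.length + 2 ∧ walkSites r l' = insert (t + dirVec e) (walkSites r l) := by
  have back : ∀ r : Site d, r + dirVec e + dirVec (e.1, !e.2) = r := fun r => by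
    rw [dirVec_not]; simp
  have detour : ∀ (r : Site d) (l : List (Fin d × Bool)),
      walkSites r (e :: (e.1, !e.2) :: l) = insert (r + dirVec e) (walkSites r l) := by
    intro r l
    simp only [walkSites, back]
    rw [Finset.insert_comm, Finset.insert_eq_of_mem (start_mem_walkSites r l)]
  induction l with
  | nil =>
    intro r ht
    obtain rfl : t = r := by simpa [walkSites] using ht
    exact ⟨[e, (e.1, !e.2)], by simp, detour t []⟩
  | cons a l ih =>
    intro r ht
    rcases Finset.mem_insert.1 ht with rfl | h
    · exact ⟨e :: (e.1, !e.2) :: a :: l, by simp, detour t _⟩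
    · obtain ⟨l', h1, h2⟩ := ih _ h
      exact ⟨a :: l', by simp [h1], by simp only [walkSites, h2, Finset.insert_comm]⟩

theorem exists_walkSites_eq {d : ℕ} {U : Finset (Site d)} (hU : IsConn (U : Set (Site d)))
    {r : Site d} (hr : r ∈ U) :
    ∃ l : List (Fin d × Bool), l.length = 2 * (U.card - 1) ∧ walkSites r l = U := by
  have key : ∀ k, k < U.card → ∃ l : List (Fin d × Bool), l.length = 2 * k ∧
      walkSites r l ⊆ U ∧ (walkSites r l).card = k + 1 := by
    intro k
    induction k with
    | zero => exact fun _ => ⟨[], by simp, by simpa [walkSites] using hr, by simp [walkSites]⟩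
    | succ k ih =>
      intro hk
      obtain ⟨l, h1, h2, h3⟩ := ih (by omega)
      obtain ⟨t, ht, s, hs, hsU, hts⟩ : ∃ t ∈ walkSites r l, ∃ s, s ∉ walkSites r l ∧ s ∈ U ∧
          IsNeighbor t s := by
        by_contra! hc
        have := hU (fun x => x ∈ walkSites r l) (fun x hx y hy hxy => by
          constructor
          · intro h
            by_contra h'
            exact hc x h y h' hy hxy
          · intro h
            by_contra h'
            exact hc y h x h' hx hxy.symm) r hr
        have : U ⊆ walkSites r l := fun y hy => (this y hy).1 (start_mem_walkSites r l)
        have := Finset.card_le_card this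
        omega
      obtain ⟨e, rfl⟩ := isNeighbor_iff.1 hts
      obtain ⟨l', h4, h5⟩ := exists_walkSites_insert e t l r ht
      refine ⟨l', by omega, ?_, ?_⟩
      · rw [h5]; exact Finset.insert_subset hsU h2
      · rw [h5, Finset.card_insert_of_notMem hs, h3]
  have hpos : 0 < U.card := Finset.card_pos.2 ⟨r, hr⟩
  obtain ⟨l, h1, h2, h3⟩ := key (U.card - 1) (by omega)
  exact ⟨l, h1, Finset.eq_of_subset_of_card_le h2 (by omega)⟩

/-- The number of connected sets of size `n` containing a given site is at most `(2d)^(2n)`. -/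
theorem card_conn_le {d : ℕ} (hd : 0 < d) (𝒰 : Finset (Finset (Site d))) (r : Site d) (n : ℕ)
    (h : ∀ U ∈ 𝒰, IsConn (U : Set (Site d)) ∧ r ∈ U ∧ U.card = n) :
    𝒰.card ≤ (2 * d) ^ (2 * n) := by
  classical
  have hsub : 𝒰 ⊆ Finset.univ.image
      fun l : List.Vector (Fin d × Bool) (2 * (n - 1)) => walkSites r l.toList := by
    intro U hU
    obtain ⟨h1, h2, h3⟩ := h U hU
    obtain ⟨l, h4, h5⟩ := exists_walkSites_eq h1 h2
    exact Finset.mem_image.2 ⟨⟨l, by rw [h4, h3]⟩, Finset.mem_univ _, h5⟩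
  refine (Finset.card_le_card hsub).trans (Finset.card_image_le.trans ?_)
  rw [Finset.card_univ, card_vector, Fintype.card_prod, Fintype.card_fin, Fintype.card_bool,
    mul_comm d]
  exact Nat.pow_le_pow_right (by omega) (by omega)

/-! ### Fronts and the size of the boundary. -/

theorem dirVec_apply_self {d : ℕ} (e : Fin d × Bool) : dirVec e e.1 = if e.2 then 1 else -1 := by
  simp [dirVec]

theorem dirVec_apply_of_ne {d : ℕ} (e : Fin d × Bool) {j : Fin d} (h : j ≠ e.1) :
    dirVec e j = 0 := by
  simp [dirVec, h]

/-- A half line that starts in a finite set leaves it. -/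
theorem exists_exit {d : ℕ} (A : Finset (Site d)) (e : Fin d × Bool) {x : Site d} (hx : x ∈ A) :
    ∃ k : ℕ, (∀ j : ℕ, j ≤ k → x + j • dirVec e ∈ A) ∧ x + (k + 1) • dirVec e ∉ A := by
  classical
  have hex : ∃ k : ℕ, x + k • dirVec e ∉ A := by
    by_contra! hc
    have hinj : Function.Injective fun k : ℕ => x + k • dirVec e := by
      intro k l hkl
      have := congrFun hkl e.1
      simp only [Pi.add_apply, Pi.smul_apply, dirVec_apply_self] at this
      split_ifs at this <;> simpa using this
    exact (Set.infinite_range_of_injective hinj) (A.finite_toSet.subset (by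
      rintro _ ⟨k, rfl⟩
      exact hc k))
  have h0 : Nat.find hex ≠ 0 := by
    intro h
    have := Nat.find_spec hex
    rw [h] at this
    simp [hx] at this
  obtain ⟨k, hk⟩ := Nat.exists_eq_succ_of_ne_zero h0
  refine ⟨k, fun j hj => ?_, ?_⟩
  · have := Nat.find_min hex (m := j) (by omega)
    simpa using this
  · have := Nat.find_spec hex
    rwa [hk] at this

/-- The sites of `A` whose predecessor in direction `e` is not in `A`. -/
noncomputable def front {d : ℕ} (A : Finset (Site d)) (e : Fin d × Bool) : Finset (Site d) :=
  A.filter fun a => a - dirVec e ∉ A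

theorem mem_front {d : ℕ} {A : Finset (Site d)} {e : Fin d × Bool} {a : Site d} :
    a ∈ front A e ↔ a ∈ A ∧ a - dirVec e ∉ A := by simp [front]

theorem isNeighbor_sub_dirVec {d : ℕ} (x : Site d) (e : Fin d × Bool) :
    IsNeighbor x (x - dirVec e) := by
  rw [sub_eq_add_neg, ← dirVec_not e.1 e.2]
  exact isNeighbor_add_dirVec _ _

/-- Every boundary site lies in some front or is the predecessor of a front site. With the direction
of largest front this gives `2 * d` directions times two sites. -/
theorem exists_card_bdry_le {d : ℕ} (hd : 0 < d) (A : Finset (Site d)) :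
    ∃ e, (bdry A).card ≤ 4 * d * (front A e).card := by
  classical
  have : NeZero d := ⟨hd.ne'⟩
  obtain ⟨e, -, he⟩ := Finset.exists_max_image (Finset.univ : Finset (Fin d × Bool))
    (fun e => (front A e).card) ⟨(0, true), Finset.mem_univ _⟩
  refine ⟨e, ?_⟩
  have hsub : bdry A ⊆ Finset.univ.biUnion fun e : Fin d × Bool =>
      front A e ∪ (front A e).image fun a => a - dirVec e := by
    intro x hx
    obtain ⟨y, h1, h2⟩ := mem_bdry.1 hx
    simp only [Finset.mem_biUnion, Finset.mem_union, Finset.mem_univ, true_and, Finset.mem_image,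
      mem_front]
    by_cases hxA : x ∈ A
    · obtain ⟨e, rfl⟩ := isNeighbor_iff.1 h1.symm
      exact ⟨e, Or.inl ⟨hxA, by simpa [hxA] using h2⟩⟩
    · obtain ⟨e, rfl⟩ := isNeighbor_iff.1 h1
      exact ⟨e, Or.inr ⟨x + dirVec e, ⟨by simpa [hxA] using h2, by simpa using hxA⟩, by simp⟩⟩
  refine (Finset.card_le_card hsub).trans ((Finset.card_biUnion_le_card_mul _ _
    (2 * (front A e).card) fun e' _ => ?_).trans ?_)
  · refine (Finset.card_union_le _ _).trans ?_
    have := Finset.card_image_le (s := front A e') (f := fun a => a - dirVec e')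
    have := he e' (Finset.mem_univ _)
    omega
  · rw [Finset.card_univ, Fintype.card_prod, Fintype.card_fin, Fintype.card_bool]
    apply le_of_eq; ring

/-- Go backwards along `e` from `v` and from a neighbour of `v` in a transverse direction: the two
parallel lines leave `A` through different front sites. In `peierls` the second front site pays for
the removed site `h`. -/
theorem two_le_card_front {d : ℕ} (hd : 2 ≤ d) {A : Finset (Site d)} {v : Site d} (hv : v ∈ A)
    (hn : ∀ y, IsNeighbor v y → y ∈ A) (e : Fin d × Bool) : 2 ≤ (front A e).card := by
  obtain ⟨j, hj⟩ : ∃ j : Fin d, j ≠ e.1 := by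
    have : Nontrivial (Fin d) := Fin.nontrivial_iff_two_le.2 hd
    exact exists_ne e.1
  have key : ∀ x ∈ A, ∃ a ∈ front A e, a j = x j := by
    intro x hx
    obtain ⟨k, h1, h2⟩ := exists_exit A (e.1, !e.2) hx
    refine ⟨x + k • dirVec (e.1, !e.2), mem_front.2 ⟨h1 k le_rfl, ?_⟩, ?_⟩
    · rw [sub_eq_add_neg, ← dirVec_not e.1 e.2, add_assoc, ← succ_nsmul]
      exact h2
    · simp [dirVec_apply_of_ne (e.1, !e.2) hj]
  obtain ⟨a, ha, haj⟩ := key v hv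
  obtain ⟨b, hb, hbj⟩ := key _ (hn _ (isNeighbor_add_dirVec v (j, true)))
  refine Finset.one_lt_card.2 ⟨a, ha, b, hb, fun hab => ?_⟩
  rw [hab, hbj] at haj
  simp [dirVec] at haj

/-- Every half line from a point of `A` meets the boundary after fewer steps than the boundary has
sites. -/
theorem exists_mem_bdry_add {d : ℕ} (hd : 2 ≤ d) {A : Finset (Site d)} {v : Site d} (hv : v ∈ A)
    (e : Fin d × Bool) : ∃ k < (bdry A).card, v + k • dirVec e ∈ bdry A := by
  classical
  obtain ⟨j, hj⟩ : ∃ j : Fin d, j ≠ e.1 := by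
    have : Nontrivial (Fin d) := Fin.nontrivial_iff_two_le.2 hd
    exact exists_ne e.1
  have exit : ∀ (f : Fin d × Bool), ∀ x ∈ A, ∃ k : ℕ, (∀ j : ℕ, j ≤ k → x + j • dirVec f ∈ A) ∧
      x + k • dirVec f ∈ bdry A := by
    intro f x hx
    obtain ⟨k, h1, h2⟩ := exists_exit A f hx
    refine ⟨k, h1, mem_bdry.2 ⟨_, isNeighbor_add_dirVec _ f, ?_⟩⟩
    rw [succ_nsmul, ← add_assoc] at h2
    have := h1 k le_rfl
    tauto
  obtain ⟨k, h1, h2⟩ := exit e v hv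
  refine ⟨k, ?_, h2⟩
  have hinj : Function.Injective fun m : ℕ => (v + m • dirVec e) e.1 := by
    intro a b hab
    simp only [Pi.add_apply, Pi.smul_apply, dirVec_apply_self] at hab
    split_ifs at hab <;> simpa using hab
  -- From each of the `k + 1` sites up to the exit, a transverse half line reaches the boundary
  -- without changing the coordinate along `e`. These boundary sites are distinct.
  have hsub : (Finset.range (k + 1)).image (fun m : ℕ => (v + m • dirVec e) e.1) ⊆
      (bdry A).image fun x => x e.1 := by
    intro z hz
    obtain ⟨m, hm, rfl⟩ := Finset.mem_image.1 hz
    obtain ⟨l, -, h4⟩ := exit (j, true) _ (h1 m (by simpa [Nat.lt_succ_iff] using hm))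
    refine Finset.mem_image.2 ⟨_, h4, ?_⟩
    simp [dirVec_apply_of_ne (j, true) hj.symm]
  have h5 := Finset.card_le_card hsub
  rw [Finset.card_image_of_injective _ hinj, Finset.card_range] at h5
  exact h5.trans Finset.card_image_le

/-! ### Phase boxes and contours. -/

open Classical in
/-- The part of the box in which the sites of colour `P` are favoured: all sites of colour `P` and
those other sites whose neighbours all lie in the box. -/
noncomputable def phaseBox {d : ℕ} (P : Site d → Prop) (N : ℕ) : Finset (Site d) :=
  (box d N).filter fun x => P x ∨ ∀ y, IsNeighbor x y → y ∈ box d N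

theorem mem_phaseBox {d : ℕ} {P : Site d → Prop} {N : ℕ} {x : Site d} :
    x ∈ phaseBox P N ↔ x ∈ box d N ∧ (P x ∨ ∀ y, IsNeighbor x y → y ∈ box d N) := by
  simp [phaseBox]

/-- No two sites of `I` are neighbours. -/
def IsIndep {d : ℕ} (I : Finset (Site d)) : Prop := ∀ x ∈ I, ∀ y ∈ I, ¬ IsNeighbor x y

/-- `A` is a simply connected region around `v` whose boundary edges carry no site of `I` and have
inner end points of colour `P`. -/
structure IsContour {d : ℕ} (P : Site d → Prop) (N : ℕ) (I : Finset (Site d)) (v : Site d)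
    (A : Finset (Site d)) : Prop where
  mem : v ∈ A
  subset : A ⊆ box d N
  conn : IsConn (A : Set (Site d))
  conn_compl : IsConn (A : Set (Site d))ᶜ
  inner : HasInnerColour P A
  inner_notMem : ∀ x ∈ A, ∀ y, y ∉ A → IsNeighbor x y → x ∉ I
  outer_notMem : ∀ x ∈ A, ∀ y, y ∉ A → IsNeighbor x y → y ∉ I

/-- The sites that can be reached from `v` through `S`. -/
def reach {d : ℕ} (S : Set (Site d)) (v : Site d) : Set (Site d) :=
  {x | Relation.ReflTransGen (fun a b => IsNeighbor a b ∧ b ∈ S) v x}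

theorem self_mem_reach {d : ℕ} (S : Set (Site d)) (v : Site d) : v ∈ reach S v :=
  Relation.ReflTransGen.refl

theorem mem_reach_of_isNeighbor {d : ℕ} {S : Set (Site d)} {v x y : Site d} (hx : x ∈ reach S v)
    (h : IsNeighbor x y) (hy : y ∈ S) : y ∈ reach S v :=
  Relation.ReflTransGen.tail hx ⟨h, hy⟩

theorem reach_subset {d : ℕ} {S : Set (Site d)} {v : Site d} (hv : v ∈ S) : reach S v ⊆ S := by
  intro x hx
  induction hx with
  | refl => exact hv
  | tail _ h _ => exact h.2

theorem isConn_reach {d : ℕ} (S : Set (Site d)) (v : Site d) : IsConn (reach S v) := by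
  intro f hf
  have key : ∀ x ∈ reach S v, (f v ↔ f x) := by
    intro x hx
    induction hx with
    | refl => exact Iff.rfl
    | tail h1 h2 ih =>
      exact ih.trans (hf _ h1 _ (mem_reach_of_isNeighbor h1 h2.1 h2.2) h2.1)
  exact fun x hx y hy => (key x hx).symm.trans (key y hy)

/-- Let `X` consist of the wrong-colour particles and their neighbours, `K` its component at `v`,
and `A` the set `K` with its holes filled. The phase box keeps `X` inside the box. An edge leaving
`A` starts in `K` and ends outside `X`. Its inner end is therefore not a wrong-colour particle but a
neighbour of one, so it has colour `P` and is vacant; its outer end has the wrong colour and would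
belong to `X` if occupied. -/
theorem exists_isContour {d : ℕ} (hd : 2 ≤ d) {P : Site d → Prop} (hP : IsParity P) {N : ℕ}
    {I : Finset (Site d)} (hI : I ⊆ phaseBox P N) (hind : IsIndep I) {v : Site d} (hv : v ∈ I)
    (hPv : ¬ P v) : ∃ A, IsContour P N I v A := by
  classical
  let X : Set (Site d) := {x | ∃ u ∈ I, ¬ P u ∧ (x = u ∨ IsNeighbor u x)}
  have hXbox : ∀ x ∈ X, x ∈ box d N := by
    rintro x ⟨u, hu, hPu, h⟩
    obtain ⟨h1, h2⟩ := mem_phaseBox.1 (hI hu)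
    rcases h with rfl | h
    · exact h1
    · exact (h2.resolve_left hPu) x h
  have hvX : v ∈ X := ⟨v, hv, hPv, Or.inl rfl⟩
  let K := reach X v
  have hKX : K ⊆ X := reach_subset hvX
  let q : Site d := fun _ => (N : ℤ) + 1
  have hq : q ∉ box d N := by
    rw [mem_box]
    push Not
    refine ⟨⟨0, by omega⟩, ?_⟩
    have := le_abs_self ((N : ℤ) + 1)
    simp only [q]
    omega
  have hqK : q ∈ Kᶜ := fun h => hq (hXbox _ (hKX h))
  let T := reach Kᶜ q
  have hTK : T ⊆ Kᶜ := reach_subset hqK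
  have hout : ∀ y, y ∉ box d N → y ∈ T := fun y hy =>
    box_compl_induction hd N (Q := fun y => y ∈ T)
      (fun a b hab hb ha => mem_reach_of_isNeighbor ha hab fun h => hb (hXbox _ (hKX h)))
      (self_mem_reach _ _) hy
  let A := (box d N).filter fun x => x ∉ T
  have hA : ∀ y, y ∈ A ↔ y ∉ T := fun y => by
    simp only [A, Finset.mem_filter, and_iff_right_iff_imp]
    intro h
    by_contra hc
    exact h (hout y hc)
  have hKA : ∀ x ∈ K, x ∈ A := fun x hx => (hA x).2 fun h => hTK h hx
  have hbK : ∀ x ∈ A, ∀ y, y ∉ A → IsNeighbor x y → x ∈ K := by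
    intro x hx y hy hxy
    rw [hA] at hx hy
    by_contra hc
    exact hx (mem_reach_of_isNeighbor (not_not.1 hy) hxy.symm hc)
  have hcompl : (A : Set (Site d))ᶜ = T := by
    ext y
    simp [hA]
  have hprop : ∀ x ∈ A, ∀ y, y ∉ A → IsNeighbor x y → P x ∧ x ∉ I ∧ y ∉ I := by
    intro x hx y hy hxy
    have hxK := hbK x hx y hy hxy
    have hyX : y ∉ X := fun h => hy (hKA y (mem_reach_of_isNeighbor hxK hxy h))
    obtain ⟨u, hu, hPu, h⟩ := hKX hxK
    have hPx : P x := by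
      rcases h with rfl | h
      · exact (hyX ⟨x, hu, hPu, Or.inr hxy⟩).elim
      · by_contra hc
        exact hPu ((hP u x h).2 hc)
    refine ⟨hPx, fun hxI => ?_, fun hyI => hyX ⟨y, hyI, (hP x y hxy).1 hPx, Or.inl rfl⟩⟩
    rcases h with rfl | h
    · exact hPu hPx
    · exact hind u hu x hxI h
  refine ⟨A, hKA v (self_mem_reach _ _), Finset.filter_subset _ _, ?_, ?_,
    fun x hx y hy h => (hprop x hx y hy h).1, fun x hx y hy h => (hprop x hx y hy h).2.1,
    fun x hx y hy h => (hprop x hx y hy h).2.2⟩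
  · intro f hf
    -- Follow a lattice path from `v`: whenever it enters `A` from outside it does so at a site of
    -- `K`, which is connected to `v` inside `A`.
    have key : ∀ y, y ∈ A → (f y ↔ f v) := by
      refine lattice_induction (v := v) (fun x y hxy hx hy => ?_) fun _ => Iff.rfl
      by_cases hxA : x ∈ A
      · exact (hf y hy x hxA hxy.symm).trans (hx hxA)
      · exact isConn_reach X v f (fun a ha b hb => hf a (hKA a ha) b (hKA b hb)) y
          (hbK y hy x hxA hxy.symm) v (self_mem_reach _ _)
    exact fun x hx y hy => (key x hx).trans (key y hy).symm
  · rw [hcompl]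
    exact isConn_reach _ _

/-! ### The shift inside a contour. -/

open Classical in
/-- Shift the part of `I` inside `A` by `e` and fill up the front. -/
noncomputable def shiftInside {d : ℕ} (A : Finset (Site d)) (e : Fin d × Bool)
    (I : Finset (Site d)) : Finset (Site d) :=
  (I \ A) ∪ ((I ∩ A).image fun x => x + dirVec e) ∪ front A e

theorem mem_shiftInside {d : ℕ} {A : Finset (Site d)} {e : Fin d × Bool} {I : Finset (Site d)}
    {z : Site d} : z ∈ shiftInside A e I ↔ (z ∈ I ∧ z ∉ A) ∨
      (z - dirVec e ∈ I ∧ z - dirVec e ∈ A) ∨ z ∈ front A e := by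
  classical
  simp only [shiftInside, Finset.mem_union, Finset.mem_sdiff, Finset.mem_image, Finset.mem_inter,
    or_assoc]
  refine or_congr Iff.rfl (or_congr ⟨?_, fun h => ⟨_, h, by simp⟩⟩ Iff.rfl)
  rintro ⟨x, h, rfl⟩
  simpa using h

namespace IsContour

variable {d : ℕ} {P : Site d → Prop} {N : ℕ} {I : Finset (Site d)} {v : Site d}
  {A : Finset (Site d)}

theorem shift_mem (h : IsContour P N I v A) (e : Fin d × Bool) {z : Site d}
    (hz : z - dirVec e ∈ I) (hzA : z - dirVec e ∈ A) : z ∈ A := by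
  by_contra hc
  exact h.inner_notMem _ hzA z hc (isNeighbor_sub_dirVec z e).symm hz

theorem neighbor_mem (h : IsContour P N I v A) {x y : Site d} (hx : x ∈ A) (hPx : ¬ P x)
    (hxy : IsNeighbor x y) : y ∈ A := by
  by_contra hc
  exact hPx (h.inner x hx y hc hxy)

/-- All of `A` lies in the phase box: a wrong-colour site of `A` has all its neighbours in `A`,
hence in the box. -/
theorem shiftInside_subset (h : IsContour P N I v A) (hI : I ⊆ phaseBox P N)
    (e : Fin d × Bool) : shiftInside A e I ⊆ phaseBox P N := by
  intro z hz
  have hA : z ∈ A → z ∈ phaseBox P N := fun hzA => by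
    refine mem_phaseBox.2 ⟨h.subset hzA, ?_⟩
    by_cases hPz : P z
    · exact Or.inl hPz
    · exact Or.inr fun y hy => h.subset (h.neighbor_mem hzA hPz hy)
  rcases mem_shiftInside.1 hz with hz | hz | hz
  · exact hI hz.1
  · exact hA (h.shift_mem e hz.1 hz.2)
  · exact hA (mem_front.1 hz).1

/-- Boundary edges carry no particle, so no outer particle touches `A`. If a shifted particle
touched a front site, shifting back would give a particle at the inner end of a boundary edge. Two
front sites have the same colour. -/
theorem isIndep_shiftInside (h : IsContour P N I v A) (hP : IsParity P) (hI : IsIndep I)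
    (e : Fin d × Bool) : IsIndep (shiftInside A e I) := by
  have outer : ∀ x y, x ∈ I ∧ x ∉ A → y ∈ A → ¬ IsNeighbor x y := fun x y hx hy hxy =>
    h.outer_notMem y hy x hx.2 hxy.symm hx.1
  have mixed : ∀ x y, x - dirVec e ∈ I ∧ x - dirVec e ∈ A → y ∈ front A e → ¬ IsNeighbor x y := by
    intro x y hx hy hxy
    refine h.inner_notMem _ hx.2 _ (mem_front.1 hy).2 ?_ hx.1
    simpa only [sub_eq_add_neg] using (isNeighbor_add_right (-dirVec e)).2 hxy
  intro x hx y hy hxy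
  rcases mem_shiftInside.1 hx with hx | hx | hx <;>
    rcases mem_shiftInside.1 hy with hy | hy | hy
  · exact hI x hx.1 y hy.1 hxy
  · exact outer x y hx (h.shift_mem e hy.1 hy.2) hxy
  · exact outer x y hx (mem_front.1 hy).1 hxy
  · exact outer y x hy (h.shift_mem e hx.1 hx.2) hxy.symm
  · refine hI _ hx.1 _ hy.1 ?_
    simpa only [sub_eq_add_neg] using (isNeighbor_add_right (-dirVec e)).2 hxy
  · exact mixed x y hx hy hxy
  · exact outer y x hy (mem_front.1 hx).1 hxy.symm
  · exact mixed y x hy hx hxy.symm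
  · rw [mem_front] at hx hy
    exact (hP x y hxy).1 (h.inner x hx.1 _ hx.2 (isNeighbor_sub_dirVec x e))
      (h.inner y hy.1 _ hy.2 (isNeighbor_sub_dirVec y e))

theorem card_shiftInside (h : IsContour P N I v A) (e : Fin d × Bool) :
    (shiftInside A e I).card = I.card + (front A e).card := by
  classical
  rw [shiftInside, Finset.card_union_of_disjoint, Finset.card_union_of_disjoint,
    Finset.card_image_of_injective _ (add_left_injective _), add_comm (I \ A).card,
    Finset.card_inter_add_card_sdiff]
  · rw [Finset.disjoint_left]
    intro z hz hz'
    obtain ⟨x, hx, rfl⟩ := Finset.mem_image.1 hz'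
    rw [Finset.mem_inter] at hx
    exact (Finset.mem_sdiff.1 hz).2 (h.shift_mem e (by simpa using hx.1) (by simpa using hx.2))
  · rw [Finset.disjoint_left]
    intro z hz hz'
    rw [mem_front] at hz'
    rcases Finset.mem_union.1 hz with hz | hz
    · exact (Finset.mem_sdiff.1 hz).2 hz'.1
    · obtain ⟨x, hx, rfl⟩ := Finset.mem_image.1 hz
      exact hz'.2 (by simpa using (Finset.mem_inter.1 hx).2)

/-- The inverse of the shift: sites added by the front are recognised by having their predecessor
outside `A`. -/
theorem mem_iff_shiftInside (h : IsContour P N I v A) (e : Fin d × Bool) (x : Site d) :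
    x ∈ I ↔ (x ∉ A ∧ x ∈ shiftInside A e I) ∨
      (x ∈ A ∧ x + dirVec e ∈ A ∧ x + dirVec e ∈ shiftInside A e I) := by
  rw [mem_shiftInside, mem_shiftInside, mem_front, mem_front, add_sub_cancel_right]
  have h1 := h.shift_mem e (z := x)
  have h2 := h.shift_mem e (z := x + dirVec e)
  rw [add_sub_cancel_right] at h2
  tauto

end IsContour

theorem shiftInside_injOn {d : ℕ} {P : Site d → Prop} {N : ℕ} {v : Site d} {A : Finset (Site d)}
    (e : Fin d × Bool) : Set.InjOn (shiftInside A e) {I | IsContour P N I v A} := by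
  intro I hI J hJ hIJ
  ext x
  rw [IsContour.mem_iff_shiftInside hI e, IsContour.mem_iff_shiftInside hJ e, hIJ]

/-! ### Hard-core partition functions and the Peierls estimate. -/

open Classical in
/-- The independent subsets of `V`. -/
noncomputable def hardCore {d : ℕ} (V : Finset (Site d)) : Finset (Finset (Site d)) :=
  V.powerset.filter IsIndep

theorem mem_hardCore {d : ℕ} {V I : Finset (Site d)} : I ∈ hardCore V ↔ I ⊆ V ∧ IsIndep I := by
  simp [hardCore]

theorem IsIndep.mono {d : ℕ} {I J : Finset (Site d)} (h : IsIndep J) (hIJ : I ⊆ J) : IsIndep I :=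
  fun x hx y hy => h x (hIJ hx) y (hIJ hy)

/-- The hard-core partition function at activity `a`. -/
noncomputable def partition {d : ℕ} (a : ℝ) (V : Finset (Site d)) : ℝ :=
  ∑ I ∈ hardCore V, a ^ I.card

theorem partition_pos {d : ℕ} {a : ℝ} (ha : 0 < a) (V : Finset (Site d)) : 0 < partition a V :=
  Finset.sum_pos (fun _ _ => pow_pos ha _)
    ⟨∅, mem_hardCore.2 ⟨Finset.empty_subset _, fun x hx => absurd hx (Finset.notMem_empty x)⟩⟩

theorem partition_le_erase {d : ℕ} {a : ℝ} (ha : 0 < a) (V : Finset (Site d)) (h : Site d) :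
    partition a V ≤ (1 + a) * partition a (V.erase h) := by
  classical
  rw [partition, ← Finset.sum_filter_add_sum_filter_not _ (fun I => h ∉ I), add_mul, one_mul]
  refine add_le_add ?_ ?_
  · refine Finset.sum_le_sum_of_subset_of_nonneg (fun I hI => ?_) fun _ _ _ => (pow_pos ha _).le
    rw [Finset.mem_filter, mem_hardCore] at hI
    exact mem_hardCore.2 ⟨Finset.subset_erase.2 ⟨hI.1.1, hI.2⟩, hI.1.2⟩
  · have e : ∀ I ∈ (hardCore V).filter (fun I => ¬ h ∉ I), a ^ I.card = a * a ^ (I.erase h).card := by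
      intro I hI
      rw [Finset.mem_filter, not_not] at hI
      rw [← pow_succ', Finset.card_erase_add_one hI.2]
    rw [Finset.sum_congr rfl e, ← Finset.mul_sum]
    refine mul_le_mul_of_nonneg_left ?_ ha.le
    rw [← Finset.sum_image (f := fun J : Finset (Site d) => a ^ J.card)
      (g := fun I : Finset (Site d) => I.erase h)]
    · refine Finset.sum_le_sum_of_subset_of_nonneg (fun J hJ => ?_) fun _ _ _ => (pow_pos ha _).le
      obtain ⟨I, hI, rfl⟩ := Finset.mem_image.1 hJ
      rw [Finset.mem_filter, mem_hardCore] at hI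
      exact mem_hardCore.2 ⟨Finset.erase_subset_erase _ hI.1.1, hI.1.2.mono (Finset.erase_subset _ _)⟩
    · intro I hI J hJ hIJ
      simp only [Finset.coe_filter, Set.mem_ofPred_eq, not_not] at hI hJ
      have := congrArg (insert h) hIJ
      rwa [Finset.insert_erase hI.2, Finset.insert_erase hJ.2] at this

theorem sum_contour_le {d : ℕ} {P : Site d → Prop} (hP : IsParity P) {N : ℕ} {v : Site d}
    {A : Finset (Site d)} {a : ℝ} (ha : 0 < a) (e : Fin d × Bool)
    (𝓘 : Finset (Finset (Site d))) (h𝓘 : ∀ I ∈ 𝓘, I ∈ hardCore (phaseBox P N))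
    (hA : ∀ I ∈ 𝓘, IsContour P N I v A) :
    (∑ I ∈ 𝓘, a ^ I.card) * a ^ (front A e).card ≤ partition a (phaseBox P N) := by
  classical
  have e1 : ∀ I ∈ 𝓘, a ^ I.card * a ^ (front A e).card = a ^ (shiftInside A e I).card := by
    intro I hI
    rw [(hA I hI).card_shiftInside, pow_add]
  rw [Finset.sum_mul, Finset.sum_congr rfl e1,
    ← Finset.sum_image (f := fun J : Finset (Site d) => a ^ J.card)
      (g := fun I : Finset (Site d) => shiftInside A e I)]
  · refine Finset.sum_le_sum_of_subset_of_nonneg (fun J hJ => ?_) fun _ _ _ => (pow_pos ha _).le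
    obtain ⟨I, hI, rfl⟩ := Finset.mem_image.1 hJ
    have h1 := mem_hardCore.1 (h𝓘 I hI)
    exact mem_hardCore.2 ⟨(hA I hI).shiftInside_subset h1.1 e,
      (hA I hI).isIndep_shiftInside hP h1.2 e⟩
  · exact (shiftInside_injOn e).mono fun I hI => hA I hI

theorem sum_pow_succ_le {M : ℝ} (hM : 1 < M) (L : ℕ) :
    ∑ n ∈ Finset.range L, (M⁻¹) ^ (n + 1) ≤ 1 / (M - 1) - (M⁻¹) ^ L / (M - 1) := by
  have h0 : M - 1 ≠ 0 := by linarith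
  have h1 : M ≠ 0 := by linarith
  induction L with
  | zero => simp
  | succ L ih =>
    rw [Finset.sum_range_succ]
    have : (M⁻¹) ^ (L + 1) = (M⁻¹) ^ L / (M - 1) - (M⁻¹) ^ (L + 1) / (M - 1) := by
      rw [pow_succ]; field_simp
    linarith

/-- Summation over the connected sets that meet a given half line close to its origin. -/
theorem sum_conn_le {d : ℕ} (hd : 0 < d) {M : ℝ} (hM : 1 < M) (𝒰 : Finset (Finset (Site d)))
    (r : ℕ → Site d)
    (h : ∀ U ∈ 𝒰, IsConn (U : Set (Site d)) ∧ ∃ k < U.card, r k ∈ U) :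
    ∑ U ∈ 𝒰, ((8 * d ^ 2 * M)⁻¹) ^ U.card ≤ 1 / (M - 1) := by
  classical
  have hd' : (0 : ℝ) < d := by exact_mod_cast hd
  have hM0 : 0 < M := by linarith
  have hcard : ∀ n, ((𝒰.filter fun U => U.card = n + 1).card : ℝ) ≤ (8 * d ^ 2) ^ (n + 1) := by
    intro n
    have hsub : (𝒰.filter fun U => U.card = n + 1) ⊆ (Finset.range (n + 1)).biUnion fun k =>
        𝒰.filter fun U => U.card = n + 1 ∧ r k ∈ U := by
      intro U hU
      rw [Finset.mem_filter] at hU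
      obtain ⟨k, hk, hkU⟩ := (h U hU.1).2
      simp only [Finset.mem_biUnion, Finset.mem_range, Finset.mem_filter]
      exact ⟨k, by omega, hU.1, hU.2, hkU⟩
    have h1 := (Finset.card_le_card hsub).trans (Finset.card_biUnion_le_card_mul _ _
      ((2 * d) ^ (2 * (n + 1))) fun k _ => card_conn_le hd _ (r k) (n + 1) fun U hU => by
        rw [Finset.mem_filter] at hU
        exact ⟨(h U hU.1).1, hU.2.2, hU.2.1⟩)
    rw [Finset.card_range] at h1
    -- The number of possible meeting points is absorbed by `n + 1 ≤ 2 ^ (n + 1)`; thus `8 * d ^ 2 =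
    -- 2 * (2 * d) ^ 2`.
    have h2 : (n + 1) * (2 * d) ^ (2 * (n + 1)) ≤ (8 * d ^ 2) ^ (n + 1) := by
      calc (n + 1) * (2 * d) ^ (2 * (n + 1)) ≤ 2 ^ (n + 1) * (2 * d) ^ (2 * (n + 1)) :=
            Nat.mul_le_mul_right _ (Nat.lt_two_pow_self).le
        _ = (8 * d ^ 2) ^ (n + 1) := by rw [pow_mul, ← mul_pow]; ring
    exact_mod_cast h1.trans h2
  let L := 𝒰.sup Finset.card
  have hmaps : ∀ U ∈ 𝒰, U.card - 1 ∈ Finset.range L := by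
    intro U hU
    obtain ⟨k, hk, -⟩ := (h U hU).2
    have : U.card ≤ L := Finset.le_sup (f := Finset.card) hU
    rw [Finset.mem_range]
    omega
  rw [← Finset.sum_fiberwise_of_maps_to hmaps]
  calc _ ≤ ∑ n ∈ Finset.range L, (M⁻¹) ^ (n + 1) := by
        refine Finset.sum_le_sum fun n _ => ?_
        have hf : (𝒰.filter fun U => U.card - 1 = n) = 𝒰.filter fun U => U.card = n + 1 := by
          refine Finset.filter_congr fun U hU => ?_
          obtain ⟨k, hk, -⟩ := (h U hU).2
          omega
        rw [hf, Finset.sum_congr rfl (g := fun _ => ((8 * d ^ 2 * M)⁻¹) ^ (n + 1)) fun U hU => by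
          rw [(Finset.mem_filter.1 hU).2], Finset.sum_const, nsmul_eq_mul]
        calc _ ≤ (8 * d ^ 2 : ℝ) ^ (n + 1) * ((8 * d ^ 2 * M)⁻¹) ^ (n + 1) :=
              mul_le_mul_of_nonneg_right (hcard n) (by positivity)
          _ = (M⁻¹) ^ (n + 1) := by
              rw [← mul_pow]
              congr 1
              field_simp
    _ ≤ 1 / (M - 1) := (sum_pow_succ_le hM L).trans (sub_le_self _ (by
        have : 0 < M - 1 := by linarith
        positivity))

/-- The Peierls estimate: in the phase in which the colour `P` is favoured, with one site removed,
a site of the other colour is unlikely to be occupied. -/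
theorem peierls {d : ℕ} (hd : 2 ≤ d) {P : Site d → Prop} (hP : IsParity P) (N : ℕ) (h v : Site d)
    (hv : ¬ P v) {a M : ℝ} (hM : 1 < M) (ha : (8 * d ^ 2 * M) ^ (8 * d) ≤ a) :
    ∑ I ∈ (hardCore ((phaseBox P N).erase h)).filter (fun I => v ∈ I), a ^ I.card ≤
      2 / (M - 1) * partition a ((phaseBox P N).erase h) := by
  classical
  have hd0 : 0 < d := by omega
  have hd' : (1 : ℝ) ≤ d := by exact_mod_cast hd0
  set R : ℝ := 8 * d ^ 2 * M with hR
  have hR1 : 1 ≤ R := by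
    have : (1 : ℝ) ≤ d ^ 2 := one_le_pow₀ hd'
    nlinarith
  have ha1 : 1 ≤ a := (one_le_pow₀ hR1).trans ha
  have ha0 : 0 < a := by linarith
  set V := phaseBox P N
  set Z := partition a (V.erase h)
  have hZ : 0 < Z := partition_pos ha0 _
  set 𝓘 := (hardCore (V.erase h)).filter (fun I => v ∈ I)
  have hex : ∀ I : Finset (Site d), ∃ A, I ∈ 𝓘 → IsContour P N I v A := by
    intro I
    by_cases hI : I ∈ 𝓘
    · obtain ⟨h1, h2⟩ := Finset.mem_filter.1 hI
      rw [mem_hardCore] at h1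
      obtain ⟨A, hA⟩ := exists_isContour hd hP (h1.1.trans (Finset.erase_subset _ _)) h1.2 h2 hv
      exact ⟨A, fun _ => hA⟩
    · exact ⟨∅, fun h => absurd h hI⟩
  choose c hc using hex
  have hΓ : ∀ A ∈ 𝓘.image c, ∃ I, IsContour P N I v A := fun A hA => by
    obtain ⟨I, hI, rfl⟩ := Finset.mem_image.1 hA
    exact ⟨I, hc I hI⟩
  have hfib : ∀ A ∈ 𝓘.image c, ∑ I ∈ 𝓘.filter (fun I => c I = A), a ^ I.card ≤
      2 * Z * (R⁻¹) ^ (bdry A).card := by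
    intro A hA
    obtain ⟨I₀, hI₀⟩ := hΓ A hA
    obtain ⟨e, he⟩ := exists_card_bdry_le hd0 A
    have hm := two_le_card_front hd hI₀.mem (fun y => hI₀.neighbor_mem hI₀.mem hv) e
    set m := (front A e).card
    have h1 := sum_contour_le hP ha0 e (𝓘.filter fun I => c I = A) (fun I hI => by
        have h1 := mem_hardCore.1 (Finset.mem_filter.1 (Finset.mem_filter.1 hI).1).1
        exact mem_hardCore.2 ⟨h1.1.trans (Finset.erase_subset _ _), h1.2⟩)
      (fun I hI => by
        obtain ⟨h1, h2⟩ := Finset.mem_filter.1 hI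
        exact h2 ▸ hc I h1)
    -- The shifted configuration may occupy `h`, so the comparison is with the full phase box.
    -- Returning to `V.erase h` costs `1 + a ≤ 2 * a`, that is, one of the `m` gained factors `a`.
    have h2 : partition a V ≤ 2 * a * Z := (partition_le_erase ha0 V h).trans
      (mul_le_mul_of_nonneg_right (by linarith) hZ.le)
    -- Since `2 ≤ m`, one has `m ≤ 2 * (m - 1)`; this turns the exponent `4 * d` into the `8 * d` of
    -- the hypothesis on `a`.
    have h3 : R ^ (bdry A).card ≤ a ^ (m - 1) := by
      calc R ^ (bdry A).card ≤ R ^ (8 * d * (m - 1)) := by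
            refine pow_le_pow_right₀ hR1 (he.trans ?_)
            calc 4 * d * m ≤ 4 * d * (2 * (m - 1)) := Nat.mul_le_mul_left _ (by omega)
              _ = 8 * d * (m - 1) := by ring
        _ = (R ^ (8 * d)) ^ (m - 1) := pow_mul _ _ _
        _ ≤ a ^ (m - 1) := pow_le_pow_left₀ (by positivity) ha _
    have h4 : a ^ m = a * a ^ (m - 1) := by rw [← pow_succ']; congr 1; omega
    set σ := ∑ I ∈ 𝓘.filter (fun I => c I = A), a ^ I.card
    have hσ : 0 ≤ σ := Finset.sum_nonneg fun _ _ => (pow_pos ha0 _).le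
    have h5 : σ * R ^ (bdry A).card ≤ 2 * Z := by
      have : a * (σ * a ^ (m - 1)) ≤ a * (2 * Z) := by
        calc a * (σ * a ^ (m - 1)) = σ * a ^ m := by rw [h4]; ring
          _ ≤ 2 * a * Z := h1.trans h2
          _ = a * (2 * Z) := by ring
      exact (mul_le_mul_of_nonneg_left h3 hσ).trans (le_of_mul_le_mul_left this ha0)
    rw [inv_pow, ← div_eq_mul_inv, le_div_iff₀ (by positivity)]
    exact h5
  rw [← Finset.sum_fiberwise_of_maps_to (fun I hI => Finset.mem_image_of_mem c hI)]
  refine (Finset.sum_le_sum hfib).trans ?_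
  rw [← Finset.mul_sum]
  have hinj : Set.InjOn bdry (𝓘.image c : Set (Finset (Site d))) := by
    intro A hA B hB hAB
    obtain ⟨I, hI⟩ := hΓ A hA
    obtain ⟨J, hJ⟩ := hΓ B hB
    exact eq_of_bdry_eq hP hI.inner hJ.inner hAB hI.mem hJ.mem
  rw [← Finset.sum_image (f := fun U : Finset (Site d) => (R⁻¹) ^ U.card) hinj]
  have := sum_conn_le hd0 hM ((𝓘.image c).image bdry)
    (fun k => v + k • dirVec (⟨0, hd0⟩, true)) (fun U hU => by
      obtain ⟨A, hA, rfl⟩ := Finset.mem_image.1 hU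
      obtain ⟨I, hI⟩ := hΓ A hA
      exact ⟨isConn_bdry hP hI.inner hI.conn hI.conn_compl, exists_mem_bdry_add hd hI.mem _⟩)
  calc _ ≤ 2 * Z * (1 / (M - 1)) := mul_le_mul_of_nonneg_left this (by positivity)
    _ = _ := by ring

/-! ### Bernoulli probabilities of finite patterns. -/

instance {d : ℕ} (p : unitInterval) : IsProbabilityMeasure (bernoulliField d p) := by
  unfold bernoulliField; infer_instance

instance {d : ℕ} (p : unitInterval) : IsProbabilityMeasure (thinnedField d p) :=
  Measure.isProbabilityMeasure_map (measurable_removeIsolated d).aemeasurable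

theorem bernoulliField_real_pattern {d : ℕ} (p : unitInterval) (W J : Finset (Site d)) :
    (bernoulliField d p).real {ω | ∀ x ∈ W, (ω x = true ↔ x ∈ J)} =
      ∏ x ∈ W, open Classical in if x ∈ J then (p : ℝ) else 1 - p := by
  classical
  have e : {ω : Config d | ∀ x ∈ W, (ω x = true ↔ x ∈ J)} =
      Set.pi (W : Set (Site d)) fun x => {decide (x ∈ J)} := by
    ext ω
    simp only [Set.mem_ofPred_eq, Set.mem_pi, Finset.mem_coe, Set.mem_singleton_iff]
    refine forall₂_congr fun x _ => ?_
    by_cases hx : x ∈ J <;> simp [hx]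
  rw [measureReal_def, e, bernoulliField,
    Measure.infinitePi_pi _ fun _ _ => MeasurableSet.singleton _, ENNReal.toReal_prod]
  refine Finset.prod_congr rfl fun x _ => ?_
  rw [← measureReal_def, bernoulliMeasure_real_apply _ (MeasurableSet.singleton _)]
  by_cases hx : x ∈ J <;> simp [hx]

/-- The set of occupied sites in `V`. -/
def occupied {d : ℕ} (V : Finset (Site d)) (ω : Config d) : Finset (Site d) :=
  V.filter fun x => ω x = true

theorem mem_occupied {d : ℕ} {V : Finset (Site d)} {ω : Config d} {x : Site d} :
    x ∈ occupied V ω ↔ x ∈ V ∧ ω x = true := by simp [occupied]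

/-- The configurations that are occupied on `S` and vacant on `B`. -/
def pinned {d : ℕ} (S B : Finset (Site d)) : Set (Config d) :=
  {ω | (∀ x ∈ S, ω x = true) ∧ ∀ x ∈ B, ω x = false}

theorem measurableSet_pinned {d : ℕ} (S B : Finset (Site d)) : MeasurableSet (pinned S B) := by
  have : pinned S B = (⋂ x ∈ S, (fun ω : Config d => ω x) ⁻¹' {true}) ∩
      ⋂ x ∈ B, (fun ω : Config d => ω x) ⁻¹' {false} := by
    ext ω; simp [pinned]
  rw [this]
  exact (Finset.measurableSet_biInter _ fun x _ =>
      measurable_pi_apply x (MeasurableSet.singleton _)).inter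
    (Finset.measurableSet_biInter _ fun x _ => measurable_pi_apply x (MeasurableSet.singleton _))

theorem measurableSet_pattern {d : ℕ} (W J : Finset (Site d)) :
    MeasurableSet {ω : Config d | ∀ x ∈ W, (ω x = true ↔ x ∈ J)} := by
  classical
  have : {ω : Config d | ∀ x ∈ W, (ω x = true ↔ x ∈ J)} =
      ⋂ x ∈ W, (fun ω : Config d => ω x) ⁻¹' {decide (x ∈ J)} := by
    ext ω
    simp only [Set.mem_ofPred_eq, Set.mem_iInter, Set.mem_preimage, Set.mem_singleton_iff]
    refine forall₂_congr fun x _ => ?_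
    by_cases hx : x ∈ J <;> simp [hx]
  rw [this]
  exact Finset.measurableSet_biInter _ fun x _ => measurable_pi_apply x (MeasurableSet.singleton _)

/-- Factoring out a vacant `V`, each particle of `I` contributes `p / (1 - p)`: this is where the
hard-core activity comes from. -/
theorem bernoulliField_real_pinned {d : ℕ} {p : unitInterval} (hp : p < 1)
    {S B V : Finset (Site d)} (hSB : Disjoint S B) (hSV : Disjoint S V) (hBV : Disjoint B V)
    (𝓕 : Finset (Finset (Site d))) (h𝓕 : ∀ I ∈ 𝓕, I ⊆ V) :
    (bernoulliField d p).real (pinned S B ∩ {ω | occupied V ω ∈ 𝓕}) =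
      (p : ℝ) ^ S.card * (1 - p) ^ (B.card + V.card) * ∑ I ∈ 𝓕, ((p : ℝ) / (1 - p)) ^ I.card := by
  classical
  have hp' : (1 : ℝ) - p ≠ 0 := by
    have : (p : ℝ) < 1 := by exact_mod_cast hp
    linarith
  have hVS : ∀ x ∈ V, x ∉ S := fun x h h' => Finset.disjoint_left.1 hSV h' h
  have hBS : ∀ x ∈ B, x ∉ S := fun x h h' => Finset.disjoint_left.1 hSB h' h
  have hBV' : ∀ x ∈ B, x ∉ V := fun x h h' => Finset.disjoint_left.1 hBV h h'
  have e : pinned S B ∩ {ω | occupied V ω ∈ 𝓕} =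
      ⋃ I ∈ 𝓕, {ω : Config d | ∀ x ∈ S ∪ B ∪ V, (ω x = true ↔ x ∈ S ∪ I)} := by
    ext ω
    simp only [Set.mem_inter_iff, Set.mem_ofPred_eq, Set.mem_iUnion, exists_prop, pinned]
    constructor
    · rintro ⟨⟨h1, h2⟩, h3⟩
      refine ⟨_, h3, fun x hx => ?_⟩
      rw [Finset.mem_union, mem_occupied]
      rw [Finset.mem_union, Finset.mem_union] at hx
      rcases hx with (hx | hx) | hx
      · simp [hx, h1 x hx]
      · simp [hBS x hx, h2 x hx]
      · simp [hVS x hx, hx]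
    · rintro ⟨I, hI, h⟩
      have hB : ∀ x ∈ B, x ∉ I := fun x hx hxI => hBV' x hx (h𝓕 I hI hxI)
      refine ⟨⟨fun x hx => (h x (by simp [hx])).2 (by simp [hx]), fun x hx => ?_⟩, ?_⟩
      · rw [← Bool.not_eq_true, h x (by simp [hx])]
        simp [hBS x hx, hB x hx]
      · convert hI
        ext x
        rw [mem_occupied]
        constructor
        · rintro ⟨h1, h2⟩
          simpa [hVS x h1] using (h x (by simp [h1])).1 h2
        · intro hx
          exact ⟨h𝓕 I hI hx, (h x (by simp [h𝓕 I hI hx])).2 (by simp [hx])⟩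
  rw [e, measureReal_biUnion_finset, Finset.mul_sum]
  · refine Finset.sum_congr rfl fun I hI => ?_
    have hIV := h𝓕 I hI
    rw [bernoulliField_real_pattern, Finset.prod_union, Finset.prod_union hSB]
    · have p1 : ∏ x ∈ S, (if x ∈ S ∪ I then (p : ℝ) else 1 - p) = (p : ℝ) ^ S.card :=
        Finset.prod_eq_pow_card fun x hx => by simp [hx]
      have p2 : ∏ x ∈ B, (if x ∈ S ∪ I then (p : ℝ) else 1 - p) = (1 - p : ℝ) ^ B.card :=
        Finset.prod_eq_pow_card fun x hx => by
          have : x ∉ I := fun h => hBV' x hx (hIV h)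
          simp [hBS x hx, this]
      have p3 : ∏ x ∈ V, (if x ∈ S ∪ I then (p : ℝ) else 1 - p) =
          (p : ℝ) ^ I.card * (1 - p) ^ (V \ I).card := by
        rw [← Finset.prod_sdiff hIV, mul_comm]
        congr 1
        · exact Finset.prod_eq_pow_card fun x hx => by simp [hx]
        · refine Finset.prod_eq_pow_card fun x hx => ?_
          rw [Finset.mem_sdiff] at hx
          simp [hVS x hx.1, hx.2]
      rw [p1, p2, p3, pow_add, div_pow, ← Finset.card_sdiff_add_card_eq_card hIV, pow_add]
      field_simp
    · rw [Finset.disjoint_union_left]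
      exact ⟨hSV, hBV⟩
  · intro I hI J hJ hIJ
    rw [Function.onFun, Set.disjoint_left]
    intro ω h1 h2
    refine hIJ ?_
    have key : ∀ I ∈ 𝓕, ∀ J ∈ 𝓕, (∀ x ∈ S ∪ B ∪ V, (ω x = true ↔ x ∈ S ∪ I)) →
        (∀ x ∈ S ∪ B ∪ V, (ω x = true ↔ x ∈ S ∪ J)) → I ⊆ J := by
      intro I hI J hJ h1 h2 x hx
      have hxV := h𝓕 I hI hx
      have h3 := (h1 x (by simp [hxV])).2 (by simp [hx])
      simpa [hVS x hxV] using (h2 x (by simp [hxV])).1 h3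
    exact (key I hI J hJ h1 h2).antisymm (key J hJ I hI h2 h1)
  · exact fun I _ => measurableSet_pattern _ _

/-! ### Consequences of quasilocality. -/

/-- A function measurable with respect to the coordinates in `Δ` depends on these only. -/
theorem eq_of_measurable_cylinderEvents {d : ℕ} {Δ : Set (Site d)} {β : Type*} [MeasurableSpace β]
    [MeasurableSingletonClass β] {F : Config d → β} (hF : Measurable[cylinderEvents Δ] F)
    {ω η : Config d} (h : ∀ x ∈ Δ, ω x = η x) : F ω = F η := by
  have hle : cylinderEvents (X := fun _ : Site d => Bool) Δ ≤
      MeasurableSpace.comap (fun (ω : Config d) (x : Δ) => ω x) MeasurableSpace.pi := by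
    refine iSup₂_le fun i hi => ?_
    rintro _ ⟨s, hs, rfl⟩
    exact ⟨(fun f : Δ → Bool => f ⟨i, hi⟩) ⁻¹' s, measurable_pi_apply _ hs, rfl⟩
  obtain ⟨t, -, ht⟩ := hle _ (hF (MeasurableSet.singleton (F η)))
  have hη : η ∈ F ⁻¹' {F η} := rfl
  have : ω ∈ F ⁻¹' {F η} := by
    rw [← ht] at hη ⊢
    have e : (fun x : Δ => ω x) = fun x : Δ => η x := funext fun x => h x x.2
    rw [Set.mem_preimage] at hη ⊢
    rwa [e]
  exact this

/-- The configurations that are vacant on `Λ`. -/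
def vacant {d : ℕ} (Λ : Finset (Site d)) : Set (Config d) := {η | ∀ x : Λ, η x = false}

theorem measurableSet_vacant {d : ℕ} (Λ : Finset (Site d)) : MeasurableSet (vacant Λ) := by
  have : vacant Λ = ⋂ x : Λ, (fun η : Config d => η x) ⁻¹' {false} := by
    ext η; simp [vacant]
  rw [this]
  exact MeasurableSet.iInter fun x => measurable_pi_apply _ (MeasurableSet.singleton _)

theorem exists_subset_box {d : ℕ} (I : Finset (Site d)) : ∃ N, I ⊆ box d N := by
  refine ⟨I.sup fun x => ∑ i, (x i).natAbs, fun x hx => mem_box.2 fun i => ?_⟩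
  have h1 : (x i).natAbs ≤ ∑ j, (x j).natAbs :=
    Finset.single_le_sum (f := fun j => (x j).natAbs) (fun _ _ => Nat.zero_le _) (Finset.mem_univ i)
  have h2 := Finset.le_sup (f := fun x : Site d => ∑ i, (x i).natAbs) hx
  have h3 := h1.trans h2
  rw [Int.abs_eq_natAbs]
  exact_mod_cast h3

/-- By properness the kernel does not alter the coordinates in `S` and `B`, so the pinning event
factors out. -/
theorem kernel_pinned_inter_vacant {d : ℕ} (γ : Specification d) (Λ S B : Finset (Site d))
    (hS : Disjoint S Λ) (hB : Disjoint B Λ) (ω : Config d) :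
    γ.kernel Λ ω (pinned S B ∩ vacant Λ) =
      (pinned S B).indicator (fun ω => γ.kernel Λ ω (vacant Λ)) ω := by
  have := γ.markov Λ ω
  have hae : ∀ᵐ η ∂(γ.kernel Λ ω), ∀ x, x ∉ Λ → η x = ω x := by
    have hm : MeasurableSet {η : Config d | ∀ x, x ∉ Λ → η x = ω x} := by
      have : {η : Config d | ∀ x, x ∉ Λ → η x = ω x} =
          ⋂ x, ⋂ _ : x ∉ Λ, (fun η : Config d => η x) ⁻¹' {ω x} := by
        ext η; simp
      rw [this]
      exact MeasurableSet.iInter fun x => MeasurableSet.iInter fun _ =>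
        measurable_pi_apply x (MeasurableSet.singleton _)
    exact (prob_compl_eq_zero_iff hm).2 (γ.proper Λ ω)
  have hpin : ∀ η : Config d, (∀ x, x ∉ Λ → η x = ω x) → (η ∈ pinned S B ↔ ω ∈ pinned S B) := by
    intro η h
    simp only [pinned, Set.mem_ofPred_eq]
    refine and_congr (forall₂_congr fun x hx => ?_) (forall₂_congr fun x hx => ?_)
    · rw [h x (Finset.disjoint_left.1 hS hx)]
    · rw [h x (Finset.disjoint_left.1 hB hx)]
  by_cases hω : ω ∈ pinned S B
  · rw [Set.indicator_of_mem hω]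
    refine measure_congr ?_
    filter_upwards [hae] with η hη
    exact propext ⟨fun h => h.2, fun h => ⟨(hpin η hη).2 hω, h⟩⟩
  · rw [Set.indicator_of_notMem hω]
    refine measure_eq_zero_iff_ae_notMem.2 ?_
    filter_upwards [hae] with η hη h
    exact hω ((hpin η hη).1 h.1)

/-- Under a quasilocal specification, the conditional probability of a vacant `Λ` hardly depends
on what is prescribed outside a large vacant box. -/
theorem Specification.IsQuasilocal.exists_box {d : ℕ} {γ : Specification d} (hq : γ.IsQuasilocal)
    {μ : Measure (Config d)} [IsProbabilityMeasure μ] (hμ : γ.IsSpecificationFor μ)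
    (Λ : Finset (Site d)) {ε : ℝ} (hε : 0 < ε) :
    ∃ (q : ℝ) (N : ℕ), ∀ S B : Finset (Site d), Disjoint S Λ → Disjoint B Λ →
      (∀ x ∈ box d N, x ∉ Λ → x ∈ B) →
      |μ.real (pinned S B ∩ vacant Λ) - q * μ.real (pinned S B)| ≤ ε * μ.real (pinned S B) := by
  classical
  let F : Config d → ENNReal := fun ω => γ.kernel Λ ω (vacant Λ)
  have hFone : ∀ ω, F ω ≤ 1 := fun ω => by
    have := γ.markov Λ ω
    exact prob_le_one
  have hFtop : ∀ ω, F ω ≠ ⊤ := fun ω => ((hFone ω).trans_lt ENNReal.one_lt_top).ne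
  have hFm' : Measurable[cylinderEvents ((Λ : Set (Site d))ᶜ)] F :=
    @Kernel.measurable_coe _ _ (cylinderEvents ((Λ : Set (Site d))ᶜ)) _ (γ.kernel Λ) _
      (measurableSet_vacant Λ)
  have hFm : Measurable F := hFm'.mono cylinderEvents_le_pi le_rfl
  have hFc : Continuous fun ω => (F ω).toReal := by
    have h1 : Continuous F := hq Λ fun _ => false
    exact continuous_iff_continuousAt.2 fun ω =>
      (ENNReal.tendsto_toReal (hFtop ω)).comp h1.continuousAt
  let ω₀ : Config d := fun _ => false
  let q := (F ω₀).toReal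
  have hopen : IsOpen ((fun ω => (F ω).toReal) ⁻¹' Metric.ball q ε) :=
    Metric.isOpen_ball.preimage hFc
  -- Only continuity at the empty configuration is needed: a basic neighbourhood of it constrains
  -- finitely many sites, which fit into a box.
  obtain ⟨I, u, h1, h2⟩ := isOpen_pi_iff.1 hopen ω₀ (Metric.mem_ball_self hε)
  obtain ⟨N, hN⟩ := exists_subset_box I
  refine ⟨q, N, fun S B hS hB hbox => ?_⟩
  have hclose : ∀ ω ∈ pinned S B, |(F ω).toReal - q| ≤ ε := by
    intro ω hω
    -- Nothing is prescribed on `Λ`; emptying it leaves `F` unchanged and makes the configuration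
    -- vacant on the whole box.
    let η : Config d := fun x => if x ∈ Λ then false else ω x
    have e : F ω = F η := eq_of_measurable_cylinderEvents hFm' fun x hx => by
      have : x ∉ Λ := by simpa using hx
      simp [η, this]
    have hη : η ∈ (I : Set (Site d)).pi u := by
      intro x hx
      have : η x = ω₀ x := by
        by_cases hxΛ : x ∈ Λ
        · simp [η, hxΛ, ω₀]
        · simp [η, hxΛ, ω₀, hω.2 x (hbox x (hN hx) hxΛ)]
      rw [this]
      exact (h1 x hx).2
    have := h2 hη
    rw [Set.mem_preimage, Metric.mem_ball, Real.dist_eq] at this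
    rw [e]
    exact this.le
  have hC := measurableSet_pinned S B
  have hint : μ (pinned S B ∩ vacant Λ) = ∫⁻ ω in pinned S B, F ω ∂μ := by
    rw [← hμ Λ _ (hC.inter (measurableSet_vacant Λ)), ← lintegral_indicator hC]
    exact lintegral_congr fun ω => kernel_pinned_inter_vacant γ Λ S B hS hB ω
  have hreal : μ.real (pinned S B ∩ vacant Λ) = ∫ ω in pinned S B, (F ω).toReal ∂μ := by
    rw [measureReal_def, hint, integral_toReal hFm.aemeasurable
      (Filter.Eventually.of_forall fun ω => (hFtop ω).lt_top)]
  have hi : Integrable (fun ω => (F ω).toReal) (μ.restrict (pinned S B)) :=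
    Integrable.of_bound hFm.ennreal_toReal.aestronglyMeasurable 1
      (Filter.Eventually.of_forall fun ω => by
        rw [Real.norm_of_nonneg ENNReal.toReal_nonneg]
        exact ENNReal.toReal_mono ENNReal.one_ne_top (hFone ω))
  have hsub : μ.real (pinned S B ∩ vacant Λ) - q * μ.real (pinned S B) =
      ∫ ω in pinned S B, ((F ω).toReal - q) ∂μ := by
    rw [integral_sub hi (integrable_const q), ← hreal]
    simp [mul_comm]
  rw [hsub, ← Real.norm_eq_abs]
  refine norm_setIntegral_le_of_norm_le_const (measure_lt_top _ _) fun ω hω => ?_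
  rw [Real.norm_eq_abs]
  exact hclose ω hω

/-! ### Screening off a phase box. -/

theorem abs_le_add_one_of_isNeighbor {d : ℕ} {x y : Site d} (h : IsNeighbor x y) (i : Fin d) :
    |y i| ≤ |x i| + 1 := by
  obtain ⟨e, rfl⟩ := isNeighbor_iff.1 h
  refine (abs_add_le _ _).trans (add_le_add_right ?_ _)
  by_cases hi : i = e.1
  · subst hi
    rw [dirVec_apply_self]
    split_ifs <;> simp
  · simp [dirVec_apply_of_ne e hi]

theorem mem_box_succ_of_isNeighbor {d N : ℕ} {x y : Site d} (hx : x ∈ box d N)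
    (h : IsNeighbor x y) : y ∈ box d (N + 1) := by
  rw [mem_box] at *
  intro i
  have := hx i
  have := abs_le_add_one_of_isNeighbor h i
  push_cast
  omega

theorem exists_isNeighbor_abs_eq {d : ℕ} (x : Site d) (i : Fin d) :
    ∃ y, IsNeighbor x y ∧ |y i| = |x i| + 1 := by
  rcases le_or_gt 0 (x i) with h | h
  · refine ⟨_, isNeighbor_add_dirVec x (i, true), ?_⟩
    rw [Pi.add_apply, dirVec_apply_self (i, true), if_pos rfl, abs_of_nonneg h,
      abs_of_nonneg (by omega)]
  · refine ⟨_, isNeighbor_add_dirVec x (i, false), ?_⟩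
    rw [Pi.add_apply, dirVec_apply_self (i, false)]
    simp only [Bool.false_eq_true, if_false]
    rw [abs_of_neg h, abs_of_neg (by omega)]
    omega

theorem notMem_box {d N : ℕ} {x : Site d} : x ∉ box d N ↔ ∃ i, (N : ℤ) < |x i| := by
  simp [mem_box]

theorem box_subset_phaseBox {d N : ℕ} (P : Site d → Prop) : box d N ⊆ phaseBox P (N + 1) := by
  intro x hx
  refine mem_phaseBox.2 ⟨mem_box.2 fun i => ?_, Or.inr fun y hy => mem_box_succ_of_isNeighbor hx hy⟩
  have := mem_box.1 hx i
  push_cast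
  omega

/-- A phase box is screened off by an occupied set `S`, from which it is separated by a layer `B`
of sites each of which has a neighbour in `S`. -/
theorem exists_screen {d : ℕ} {P : Site d → Prop} (hP : IsParity P) (N : ℕ) :
    ∃ S B : Finset (Site d), Disjoint S B ∧ Disjoint S (phaseBox P N) ∧
      Disjoint B (phaseBox P N) ∧
      (∀ x ∈ phaseBox P N, ∀ y, IsNeighbor x y → y ∈ phaseBox P N ∨ y ∈ B) ∧
      (∀ x ∈ B, ∃ y ∈ S, IsNeighbor x y) ∧ ∀ x ∈ S, ∃ y ∈ S, IsNeighbor x y := by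
  classical
  -- `S₁` supplies each site of the layer `B` with an occupied neighbour. `S₂`, one step further out
  -- and of the other colour, gives each site of `S₁` a neighbour, so that none is deleted.
  let S₁ := (box d (N + 2)).filter fun x => P x ∧ x ∉ box d N
  let S₂ := (box d (N + 3)).filter fun x => ¬ P x ∧ x ∉ box d (N + 1) ∧ ∃ y ∈ S₁, IsNeighbor x y
  let B := ((phaseBox P N).biUnion nbrs) \ phaseBox P N
  have hS₁ : ∀ x, x ∈ S₁ ↔ x ∈ box d (N + 2) ∧ P x ∧ x ∉ box d N := fun x => by simp [S₁]
  have hS₂ : ∀ x, x ∈ S₂ ↔ x ∈ box d (N + 3) ∧ ¬ P x ∧ x ∉ box d (N + 1) ∧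
      ∃ y ∈ S₁, IsNeighbor x y := fun x => by simp only [S₂, Finset.mem_filter]
  have hbox : ∀ x, x ∈ box d N → x ∈ box d (N + 1) := fun x hx => by
    rw [mem_box] at *
    intro i
    have := hx i
    push_cast
    omega
  have hB : ∀ x ∈ B, ¬ P x ∧ x ∈ box d (N + 1) ∧ ∃ y ∈ S₁, IsNeighbor x y := by
    intro x hx
    obtain ⟨hx1, hxV⟩ := Finset.mem_sdiff.1 hx
    obtain ⟨y, hyV, hyx⟩ := Finset.mem_biUnion.1 hx1
    rw [mem_nbrs] at hyx
    obtain ⟨hybox, hy⟩ := mem_phaseBox.1 hyV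
    have hPy : P y := by
      by_contra hc
      have h1 := hy.resolve_left hc x hyx
      exact hxV (mem_phaseBox.2 ⟨h1, Or.inl (by_contra fun h => hc ((hP y x hyx).2 h))⟩)
    have hPx := (hP y x hyx).1 hPy
    have hx' := mem_box_succ_of_isNeighbor hybox hyx
    refine ⟨hPx, hx', ?_⟩
    have hPn : ∀ z, IsNeighbor x z → P z := fun z hz =>
      by_contra fun h => hPx ((hP x z hz).2 h)
    by_cases hxb : x ∈ box d N
    · have : ∃ z, IsNeighbor x z ∧ z ∉ box d N := by
        by_contra! hc
        exact hxV (mem_phaseBox.2 ⟨hxb, Or.inr hc⟩)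
      obtain ⟨z, hz, hzb⟩ := this
      exact ⟨z, (hS₁ z).2 ⟨mem_box_succ_of_isNeighbor hx' hz, hPn z hz, hzb⟩, hz⟩
    · obtain ⟨i, hi⟩ := notMem_box.1 hxb
      obtain ⟨z, hz, hzi⟩ := exists_isNeighbor_abs_eq x i
      exact ⟨z, (hS₁ z).2 ⟨mem_box_succ_of_isNeighbor hx' hz, hPn z hz,
        notMem_box.2 ⟨i, by omega⟩⟩, hz⟩
  refine ⟨S₁ ∪ S₂, B, ?_, ?_, Finset.sdiff_disjoint, ?_, ?_, ?_⟩
  · rw [Finset.disjoint_left]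
    intro x hx hxB
    obtain ⟨h1, h2, -⟩ := hB x hxB
    rcases Finset.mem_union.1 hx with h | h
    · exact h1 ((hS₁ x).1 h).2.1
    · exact ((hS₂ x).1 h).2.2.1 h2
  · rw [Finset.disjoint_left]
    intro x hx hxV
    have h1 := (mem_phaseBox.1 hxV).1
    rcases Finset.mem_union.1 hx with h | h
    · exact ((hS₁ x).1 h).2.2 h1
    · exact ((hS₂ x).1 h).2.2.1 (hbox x h1)
  · intro x hx y hxy
    by_cases hy : y ∈ phaseBox P N
    · exact Or.inl hy
    · exact Or.inr (Finset.mem_sdiff.2 ⟨Finset.mem_biUnion.2 ⟨x, hx, mem_nbrs.2 hxy⟩, hy⟩)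
  · intro x hx
    obtain ⟨-, -, y, hy, hxy⟩ := hB x hx
    exact ⟨y, Finset.mem_union_left _ hy, hxy⟩
  · intro x hx
    rcases Finset.mem_union.1 hx with h | h
    · obtain ⟨h1, h2, h3⟩ := (hS₁ x).1 h
      obtain ⟨i, hi⟩ := notMem_box.1 h3
      obtain ⟨z, hz, hzi⟩ := exists_isNeighbor_abs_eq x i
      refine ⟨z, Finset.mem_union_right _ ((hS₂ z).2 ⟨mem_box_succ_of_isNeighbor h1 hz,
        (hP x z hz).1 h2, notMem_box.2 ⟨i, ?_⟩, x, h, hz.symm⟩), hz⟩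
      push_cast
      omega
    · obtain ⟨-, -, -, y, hy, hxy⟩ := (hS₂ x).1 h
      exact ⟨y, Finset.mem_union_left _ hy, hxy⟩

/-! ### Conditioning the image field around the origin. -/

/-- The origin and its neighbours. -/
noncomputable def cross (d : ℕ) : Finset (Site d) := open Classical in insert 0 (nbrs 0)

theorem mem_cross {d : ℕ} {x : Site d} : x ∈ cross d ↔ x = 0 ∨ IsNeighbor 0 x := by
  simp [cross]

open Classical in
/-- The subsets of `V` in which the only neighbouring pairs contain the origin. -/
noncomputable def starCore {d : ℕ} (V : Finset (Site d)) : Finset (Finset (Site d)) :=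
  V.powerset.filter fun I => ∀ x ∈ I, ∀ y ∈ I, IsNeighbor x y → x = 0 ∨ y = 0

theorem mem_starCore {d : ℕ} {V I : Finset (Site d)} : I ∈ starCore V ↔
    I ⊆ V ∧ ∀ x ∈ I, ∀ y ∈ I, IsNeighbor x y → x = 0 ∨ y = 0 := by simp [starCore]

theorem removeIsolated_eq_true {d : ℕ} {ω : Config d} {x : Site d} :
    removeIsolated ω x = true ↔ ω x = true ∧ ∃ y, IsNeighbor x y ∧ ω y = true := by
  simp [removeIsolated]

theorem removeIsolated_eq_false {d : ℕ} {ω : Config d} {x : Site d} :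
    removeIsolated ω x = false ↔ (ω x = true → ∀ y, IsNeighbor x y → ω y = false) := by
  rw [← Bool.not_eq_true, removeIsolated_eq_true]
  simp

/-- The event that the origin and one of its neighbours are occupied, for subsets of a volume. -/
def OriginActive {d : ℕ} (I : Finset (Site d)) : Prop := 0 ∈ I ∧ ∃ y ∈ I, IsNeighbor 0 y

section screened

variable {d : ℕ} {P : Site d → Prop} {S B V : Finset (Site d)}

-- Sites of `S` support each other and survive. A particle on `B` would survive next to `S`, so a
-- vacant image forces `B` vacant. A neighbouring pair in `V` survives at both ends, so both lie in
-- `cross d`.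
open Classical in
theorem removeIsolated_mem_pinned_iff (hP : IsParity P) (hstar : cross d ⊆ V)
    (hBV : Disjoint B V) (hV : ∀ x ∈ V, ∀ y, IsNeighbor x y → y ∈ V ∨ y ∈ B)
    (hB : ∀ x ∈ B, ∃ y ∈ S, IsNeighbor x y) (hS : ∀ x ∈ S, ∃ y ∈ S, IsNeighbor x y)
    (ω : Config d) :
    removeIsolated ω ∈ pinned S ((V ∪ B) \ cross d) ↔
      ω ∈ pinned S B ∧ occupied V ω ∈ starCore V := by
  have hBstar : ∀ x ∈ B, x ∉ cross d := fun x hx h => Finset.disjoint_left.1 hBV hx (hstar h)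
  constructor
  · rintro ⟨h1, h2⟩
    have hS1 : ∀ x ∈ S, ω x = true := fun x hx => (removeIsolated_eq_true.1 (h1 x hx)).1
    refine ⟨⟨hS1, fun x hx => ?_⟩, mem_starCore.2 ⟨Finset.filter_subset _ _, ?_⟩⟩
    · obtain ⟨y, hy, hxy⟩ := hB x hx
      have h3 := removeIsolated_eq_false.1 (h2 x (by simp [hx, hBstar x hx]))
      by_contra hc
      have := h3 (by simpa using hc) y hxy
      rw [hS1 y hy] at this
      exact absurd this (by simp)
    · intro x hx y hy hxy
      rw [mem_occupied] at hx hy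
      have key : ∀ x y, x ∈ V → ω x = true → ω y = true → IsNeighbor x y → x ∈ cross d := by
        intro x y hxV hx hy hxy
        by_contra hc
        have := removeIsolated_eq_false.1 (h2 x (by simp [hxV, hc])) hx y hxy
        rw [hy] at this
        exact absurd this (by simp)
      have sx := mem_cross.1 (key x y hx.1 hx.2 hy.2 hxy)
      have sy := mem_cross.1 (key y x hy.1 hy.2 hx.2 hxy.symm)
      rcases sx with h | h
      · exact Or.inl h
      rcases sy with h' | h'
      · exact Or.inr h'
      -- Two neighbours of the origin have equal colour and cannot be adjacent.
      have p1 := hP _ _ h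
      have p2 := hP _ _ h'
      have p3 := hP _ _ hxy
      tauto
  · rintro ⟨⟨h1, h2⟩, h3⟩
    refine ⟨fun x hx => ?_, fun x hx => removeIsolated_eq_false.2 fun hωx y hxy => ?_⟩
    · obtain ⟨y, hy, hxy⟩ := hS x hx
      exact removeIsolated_eq_true.2 ⟨h1 x hx, y, hxy, h1 y hy⟩
    · rw [Finset.mem_sdiff, Finset.mem_union] at hx
      have hxV : x ∈ V := hx.1.resolve_right fun h => by simp [h2 x h] at hωx
      by_contra hc
      have hωy : ω y = true := by simpa using hc
      have hyV : y ∈ V := (hV x hxV y hxy).resolve_right fun h => by simp [h2 y h] at hωy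
      refine hx.2 (mem_cross.2 ?_)
      rcases (mem_starCore.1 h3).2 x (mem_occupied.2 ⟨hxV, hωx⟩) y (mem_occupied.2 ⟨hyV, hωy⟩) hxy
        with h | h
      · exact Or.inl h
      · exact Or.inr (h ▸ hxy.symm)

theorem removeIsolated_mem_vacant_iff (hstar : cross d ⊆ V)
    (hV : ∀ x ∈ V, ∀ y, IsNeighbor x y → y ∈ V ∨ y ∈ B) {ω : Config d} (hω : ω ∈ pinned S B)
    (hcore : occupied V ω ∈ starCore V) :
    removeIsolated ω ∈ vacant (cross d) ↔ ¬ OriginActive (occupied V ω) := by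
  constructor
  · rintro h ⟨h0, y, hy, h0y⟩
    rw [mem_occupied] at h0 hy
    have := removeIsolated_eq_false.1 (h ⟨0, mem_cross.2 (Or.inl rfl)⟩) h0.2 y h0y
    rw [hy.2] at this
    exact absurd this (by simp)
  · rintro h ⟨x, hx⟩
    refine removeIsolated_eq_false.2 fun hωx y hxy => ?_
    by_contra hc
    have hωy : ω y = true := by simpa using hc
    have hxV := hstar hx
    have hyV : y ∈ V := (hV x hxV y hxy).resolve_right fun h => by simp [hω.2 y h] at hωy
    have hxI : x ∈ occupied V ω := mem_occupied.2 ⟨hxV, hωx⟩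
    have hyI : y ∈ occupied V ω := mem_occupied.2 ⟨hyV, hωy⟩
    rcases (mem_starCore.1 hcore).2 x hxI y hyI hxy with h' | h'
    · subst h'
      exact h ⟨hxI, y, hyI, hxy⟩
    · subst h'
      exact h ⟨hyI, x, hxI, hxy.symm⟩

end screened

-- The origin is unconstrained: a set belongs to `starCore V` exactly when its part off the origin
-- is independent. The two terms are the cases of a vacant and an occupied origin.
open Classical in
theorem sum_starCore {d : ℕ} {V : Finset (Site d)}
    (h0 : (0 : Site d) ∈ V) (a : ℝ) (Φ : Finset (Site d) → Prop)
    [DecidablePred Φ] [DecidablePred fun I => Φ (insert 0 I)] :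
    ∑ I ∈ (starCore V).filter Φ, a ^ I.card =
      ∑ I ∈ (hardCore (V.erase 0)).filter Φ, a ^ I.card +
        a * ∑ I ∈ (hardCore (V.erase 0)).filter (fun I => Φ (insert 0 I)), a ^ I.card := by
  have key : ∀ I ∈ (V.erase 0).powerset,
      ((∀ x ∈ I, ∀ y ∈ I, IsNeighbor x y → x = 0 ∨ y = 0) ↔ IsIndep I) ∧
      ((∀ x ∈ insert 0 I, ∀ y ∈ insert 0 I, IsNeighbor x y → x = 0 ∨ y = 0) ↔ IsIndep I) := by
    intro I hI
    have hne : ∀ x ∈ I, x ≠ 0 := fun x hx => (Finset.mem_erase.1 (Finset.mem_powerset.1 hI hx)).1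
    constructor
    · constructor
      · intro h x hx y hy hxy
        rcases h x hx y hy hxy with h | h
        · exact hne x hx h
        · exact hne y hy h
      · intro h x hx y hy hxy
        exact (h x hx y hy hxy).elim
    · constructor
      · intro h x hx y hy hxy
        rcases h x (by simp [hx]) y (by simp [hy]) hxy with h | h
        · exact hne x hx h
        · exact hne y hy h
      · intro h x hx y hy hxy
        rcases Finset.mem_insert.1 hx with hx | hx
        · exact Or.inl hx
        rcases Finset.mem_insert.1 hy with hy | hy
        · exact Or.inr hy
        exact (h x hx y hy hxy).elim
  rw [starCore, Finset.filter_filter, Finset.sum_filter]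
  conv_lhs => rw [← Finset.insert_erase h0]
  rw [Finset.sum_powerset_insert (Finset.notMem_erase _ _), hardCore, Finset.filter_filter,
    Finset.filter_filter, Finset.sum_filter, Finset.sum_filter, Finset.mul_sum]
  congr 1
  · exact Finset.sum_congr rfl fun I hI => by simp only [(key I hI).1]
  · refine Finset.sum_congr rfl fun I hI => ?_
    have : (0 : Site d) ∉ I := fun h =>
      (Finset.mem_erase.1 (Finset.mem_powerset.1 hI h)).1 rfl
    simp only [(key I hI).2, Finset.card_insert_of_notMem this, pow_succ', mul_ite, mul_zero]

open Classical in
/-- The weight of the independent subsets of `V` that contain a neighbour of the origin. -/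
noncomputable def activeWeight {d : ℕ} (a : ℝ) (V : Finset (Site d)) : ℝ :=
  ∑ I ∈ (hardCore V).filter (fun I => ∃ y ∈ I, IsNeighbor 0 y), a ^ I.card

theorem not_isNeighbor_self {d : ℕ} (x : Site d) : ¬ IsNeighbor x x := by
  simp [IsNeighbor]

open Classical in
theorem sum_starCore_not_active {d : ℕ}
    {V : Finset (Site d)} (h0 : (0 : Site d) ∈ V) (a : ℝ) :
    ∑ I ∈ (starCore V).filter (fun I => ¬ OriginActive I), a ^ I.card =
      (1 + a) * partition a (V.erase 0) - a * activeWeight a (V.erase 0) := by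
  rw [sum_starCore h0]
  have e1 : (hardCore (V.erase 0)).filter (fun I => ¬ OriginActive I) = hardCore (V.erase 0) := by
    refine Finset.filter_true_of_mem fun I hI h => ?_
    exact (Finset.mem_erase.1 ((mem_hardCore.1 hI).1 h.1)).1 rfl
  have e2 : (hardCore (V.erase 0)).filter (fun I => ¬ OriginActive (insert 0 I)) =
      (hardCore (V.erase 0)).filter (fun I => ¬ ∃ y ∈ I, IsNeighbor 0 y) := by
    refine Finset.filter_congr fun I _ => not_congr ?_
    simp [OriginActive, not_isNeighbor_self]
  have e3 := Finset.sum_filter_add_sum_filter_not (hardCore (V.erase 0))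
    (fun I => ∃ y ∈ I, IsNeighbor 0 y) (fun I => a ^ I.card)
  rw [e1, e2, partition, activeWeight, ← e3]
  ring

theorem sum_starCore_univ {d : ℕ}
    {V : Finset (Site d)} (h0 : (0 : Site d) ∈ V) (a : ℝ) :
    ∑ I ∈ starCore V, a ^ I.card = (1 + a) * partition a (V.erase 0) := by
  classical
  have := sum_starCore h0 a fun _ => True
  simp only [Finset.filter_true] at this
  rw [this, partition]
  ring

/-- The law of the thinned field at the origin, given a screened phase box, is governed by the
hard-core model with the origin removed. -/
theorem exists_conditioning {d : ℕ} {P : Site d → Prop} (hP : IsParity P) {p : unitInterval}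
    (hp0 : 0 < p) (hp1 : p < 1) (N : ℕ) (hstar : cross d ⊆ phaseBox P N) :
    ∃ (S B : Finset (Site d)) (κ : ℝ), Disjoint S (cross d) ∧ Disjoint B (cross d) ∧
      (∀ x ∈ phaseBox P N, x ∉ cross d → x ∈ B) ∧ 0 < κ ∧
      (thinnedField d p).real (pinned S B) = κ * ((1 + (p : ℝ) / (1 - p)) *
        partition ((p : ℝ) / (1 - p)) ((phaseBox P N).erase 0)) ∧
      (thinnedField d p).real (pinned S B ∩ vacant (cross d)) = κ * ((1 + (p : ℝ) / (1 - p)) *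
        partition ((p : ℝ) / (1 - p)) ((phaseBox P N).erase 0) -
        (p : ℝ) / (1 - p) * activeWeight ((p : ℝ) / (1 - p)) ((phaseBox P N).erase 0)) := by
  classical
  obtain ⟨S, B, hSB, hSV, hBV, hV, hB, hS⟩ := exists_screen hP N
  set V := phaseBox P N
  have h0 : (0 : Site d) ∈ V := hstar (mem_cross.2 (Or.inl rfl))
  have hp0' : (0 : ℝ) < p := by exact_mod_cast hp0
  have hp1' : (p : ℝ) < 1 := by exact_mod_cast hp1
  have hiff := removeIsolated_mem_pinned_iff hP hstar hBV hV hB hS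
  refine ⟨S, (V ∪ B) \ cross d, (p : ℝ) ^ S.card * (1 - p) ^ (B.card + V.card),
    hSV.mono_right hstar, Finset.sdiff_disjoint, fun x hx hx' => by simp [hx, hx'],
    mul_pos (pow_pos hp0' _) (pow_pos (by linarith) _), ?_, ?_⟩
  · rw [thinnedField, map_measureReal_apply (measurable_removeIsolated d)
      (measurableSet_pinned _ _), ← sum_starCore_univ h0,
      ← bernoulliField_real_pinned hp1 hSB hSV hBV _ fun I hI => (mem_starCore.1 hI).1]
    congr 1
    ext ω
    exact hiff ω
  · rw [thinnedField, map_measureReal_apply (measurable_removeIsolated d)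
      ((measurableSet_pinned _ _).inter (measurableSet_vacant _)),
      ← sum_starCore_not_active h0,
      ← bernoulliField_real_pinned hp1 hSB hSV hBV _ fun I hI =>
        (mem_starCore.1 (Finset.mem_filter.1 hI).1).1]
    congr 1
    ext ω
    simp only [Set.mem_preimage, Set.mem_inter_iff, hiff ω, Set.mem_ofPred_eq, Finset.mem_filter]
    constructor
    · rintro ⟨⟨h1, h2⟩, h3⟩
      exact ⟨h1, h2, (removeIsolated_mem_vacant_iff hstar hV h1 h2).1 h3⟩
    · rintro ⟨h1, h2, h3⟩
      exact ⟨⟨h1, h2⟩, (removeIsolated_mem_vacant_iff hstar hV h1 h2).2 h3⟩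

/-! ### The two phases and the contradiction. -/

theorem sum_union_le_add {α : Type*} [DecidableEq α] (s t : Finset α) {f : α → ℝ}
    (hf : ∀ x, 0 ≤ f x) : ∑ x ∈ s ∪ t, f x ≤ ∑ x ∈ s, f x + ∑ x ∈ t, f x := by
  rw [← Finset.sum_union_inter]
  exact le_add_of_nonneg_right (Finset.sum_nonneg fun x _ => hf x)

theorem sum_biUnion_le_sum {α β : Type*} [DecidableEq α] [DecidableEq β] (s : Finset β)
    (t : β → Finset α) {f : α → ℝ} (hf : ∀ x, 0 ≤ f x) :
    ∑ x ∈ s.biUnion t, f x ≤ ∑ y ∈ s, ∑ x ∈ t y, f x := by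
  induction s using Finset.induction_on with
  | empty => simp
  | insert b s hb ih =>
    rw [Finset.biUnion_insert, Finset.sum_insert hb]
    exact (sum_union_le_add _ _ hf).trans (add_le_add_right ih _)

theorem sum_nbrs_le {d : ℕ} (hd : 2 ≤ d) {P : Site d → Prop} (hP : IsParity P) (N : ℕ)
    (h w : Site d) (hw : P w) {a : ℝ} (ha : (8 * d ^ 2 * (64 * d + 1) : ℝ) ^ (8 * d) ≤ a)
    (ha0 : 0 < a) :
    ∑ y ∈ nbrs w, ∑ I ∈ (hardCore ((phaseBox P N).erase h)).filter (fun I => y ∈ I), a ^ I.card ≤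
      1 / 16 * partition a ((phaseBox P N).erase h) := by
  have hd' : (0 : ℝ) < d := by exact_mod_cast (by omega : 0 < d)
  have hZ := partition_pos ha0 ((phaseBox P N).erase h)
  -- Here `M = 64 * d + 1`, chosen so that `2 * d` neighbours contribute `2 * d * (2 / (64 * d)) = 1
  -- / 16`.
  refine (Finset.sum_le_card_nsmul _ _ _ fun y hy => peierls hd hP N h y
    ((hP w y (mem_nbrs.1 hy)).1 hw) (by linarith) ha).trans ?_
  have hc : ((nbrs w).card : ℝ) ≤ 2 * d := by exact_mod_cast card_nbrs_le w
  rw [nsmul_eq_mul, ← mul_assoc]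
  refine mul_le_mul_of_nonneg_right ?_ hZ.le
  calc ((nbrs w).card : ℝ) * (2 / (64 * d + 1 - 1)) ≤ 2 * d * (2 / (64 * d + 1 - 1)) :=
        mul_le_mul_of_nonneg_right hc (by rw [add_sub_cancel_right]; positivity)
    _ = 1 / 16 := by field_simp; ring

theorem activeWeight_le {d : ℕ} (hd : 2 ≤ d) {P : Site d → Prop} (hP : IsParity P) (N : ℕ)
    (h0 : P 0) {a : ℝ} (ha : (8 * d ^ 2 * (64 * d + 1) : ℝ) ^ (8 * d) ≤ a) (ha0 : 0 < a) :
    activeWeight a ((phaseBox P N).erase 0) ≤ 1 / 16 * partition a ((phaseBox P N).erase 0) := by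
  classical
  refine le_trans ?_ (sum_nbrs_le hd hP N 0 0 h0 ha ha0)
  have : ((hardCore ((phaseBox P N).erase 0)).filter fun I => ∃ y ∈ I, IsNeighbor 0 y) ⊆
      (nbrs 0).biUnion fun y => (hardCore ((phaseBox P N).erase 0)).filter fun I => y ∈ I := by
    intro I hI
    obtain ⟨h1, y, h2, h3⟩ := Finset.mem_filter.1 hI
    simp only [Finset.mem_biUnion, Finset.mem_filter, mem_nbrs]
    exact ⟨y, h3, h1, h2⟩
  exact (Finset.sum_le_sum_of_subset_of_nonneg this fun _ _ _ => (pow_pos ha0 _).le).trans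
    (sum_biUnion_le_sum _ _ fun _ => (pow_pos ha0 _).le)

/-- Fix a neighbour `w` of the origin; it has the favoured colour. If `w` is vacant, either a
neighbour of `w` is occupied, with weight at most `1/16`, or `w` can be filled at a gain of `a ≥
16`, so this case also weighs at most `1/16`. -/
theorem le_activeWeight {d : ℕ} (hd : 2 ≤ d) {P : Site d → Prop} (hP : IsParity P) (N : ℕ)
    (hstar : cross d ⊆ phaseBox P N) (h0 : ¬ P 0) {a : ℝ}
    (ha : (8 * d ^ 2 * (64 * d + 1) : ℝ) ^ (8 * d) ≤ a) (ha16 : 16 ≤ a) :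
    7 / 8 * partition a ((phaseBox P N).erase 0) ≤ activeWeight a ((phaseBox P N).erase 0) := by
  classical
  have ha0 : 0 < a := by linarith
  let w : Site d := 0 + dirVec (⟨0, by omega⟩, true)
  have hw : IsNeighbor 0 w := isNeighbor_add_dirVec _ _
  have hPw : P w := by_contra fun h => h0 ((hP 0 w hw).2 h)
  have hw0 : w ≠ 0 := fun h => not_isNeighbor_self _ (h ▸ hw)
  set V := (phaseBox P N).erase 0
  have hwV : w ∈ V := Finset.mem_erase.2 ⟨hw0, hstar (mem_cross.2 (Or.inr hw))⟩
  have hpos : ∀ I : Finset (Site d), 0 ≤ a ^ I.card := fun I => (pow_pos ha0 _).le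
  have hsplit := Finset.sum_filter_add_sum_filter_not (hardCore V) (fun I => w ∈ I)
    (fun I => a ^ I.card)
  have h1 : ∑ I ∈ (hardCore V).filter (fun I => w ∈ I), a ^ I.card ≤ activeWeight a V :=
    Finset.sum_le_sum_of_subset_of_nonneg (fun I hI => by
      rw [Finset.mem_filter] at *
      exact ⟨hI.1, w, hI.2, hw⟩) fun I _ _ => hpos I
  let 𝓔 := (hardCore V).filter fun I => w ∉ I ∧ ∀ y ∈ I, ¬ IsNeighbor w y
  have hsub : (hardCore V).filter (fun I => w ∉ I) ⊆
      ((nbrs w).biUnion fun y => (hardCore V).filter fun I => y ∈ I) ∪ 𝓔 := by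
    intro I hI
    rw [Finset.mem_filter] at hI
    by_cases h : ∃ y ∈ I, IsNeighbor w y
    · obtain ⟨y, hy, hwy⟩ := h
      refine Finset.mem_union_left _ ?_
      simp only [Finset.mem_biUnion, Finset.mem_filter, mem_nbrs]
      exact ⟨y, hwy, hI.1, hy⟩
    · push Not at h
      exact Finset.mem_union_right _ (Finset.mem_filter.2 ⟨hI.1, hI.2, h⟩)
  have h2 : a * ∑ I ∈ 𝓔, a ^ I.card ≤ partition a V := by
    rw [Finset.mul_sum]
    have e : ∀ I ∈ 𝓔, a * a ^ I.card = a ^ (insert w I).card := fun I hI => by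
      rw [Finset.card_insert_of_notMem (Finset.mem_filter.1 hI).2.1, pow_succ']
    rw [Finset.sum_congr rfl e, ← Finset.sum_image (f := fun J : Finset (Site d) => a ^ J.card)
      (g := fun I : Finset (Site d) => insert w I)]
    · refine Finset.sum_le_sum_of_subset_of_nonneg (fun J hJ => ?_) fun I _ _ => hpos I
      obtain ⟨I, hI, rfl⟩ := Finset.mem_image.1 hJ
      obtain ⟨h3, -, h5⟩ := Finset.mem_filter.1 hI
      rw [mem_hardCore] at h3 ⊢
      refine ⟨Finset.insert_subset hwV h3.1, fun x hx y hy hxy => ?_⟩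
      rcases Finset.mem_insert.1 hx with rfl | hx <;> rcases Finset.mem_insert.1 hy with hy | hy
      · exact not_isNeighbor_self _ (hy ▸ hxy)
      · exact h5 y hy hxy
      · exact h5 x hx (hy ▸ hxy.symm)
      · exact h3.2 x hx y hy hxy
    · intro I hI J hJ hIJ
      have hI' := (Finset.mem_filter.1 hI).2.1
      have hJ' := (Finset.mem_filter.1 hJ).2.1
      have := congrArg (fun K => Finset.erase K w) hIJ
      simpa only [Finset.erase_insert hI', Finset.erase_insert hJ'] using this
  have h3 : ∑ I ∈ (hardCore V).filter (fun I => w ∉ I), a ^ I.card ≤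
      1 / 16 * partition a V + ∑ I ∈ 𝓔, a ^ I.card := by
    refine (Finset.sum_le_sum_of_subset_of_nonneg hsub fun I _ _ => hpos I).trans
      ((sum_union_le_add _ _ hpos).trans (add_le_add_left ?_ _))
    exact (sum_biUnion_le_sum _ _ hpos).trans
      (sum_nbrs_le hd hP N 0 w hPw ha ha0)
  have h4 : 16 * ∑ I ∈ 𝓔, a ^ I.card ≤ partition a V :=
    (mul_le_mul_of_nonneg_right ha16 (Finset.sum_nonneg fun I _ => hpos I)).trans h2
  have h5 : ∑ I ∈ (hardCore V).filter (fun I => w ∈ I), a ^ I.card +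
    ∑ I ∈ (hardCore V).filter (fun I => w ∉ I), a ^ I.card = partition a V := hsplit
  linarith

theorem box_mono {d M N : ℕ} (h : M ≤ N) : box d M ⊆ box d N := by
  intro x hx
  rw [mem_box] at *
  exact fun i => (hx i).trans (by exact_mod_cast h)

theorem cross_subset_box (d N : ℕ) : cross d ⊆ box d (N + 1) := by
  have h0 : (0 : Site d) ∈ box d 0 := mem_box.2 fun i => by simp
  intro x hx
  refine box_mono (Nat.le_add_left 1 N) ?_
  rcases mem_cross.1 hx with rfl | hx
  · exact box_mono (Nat.zero_le 1) h0
  · exact mem_box_succ_of_isNeighbor h0 hx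

theorem isParity_even (d : ℕ) : IsParity fun x : Site d => Even (∑ i, x i) :=
  fun _ _ h => h.even_iff

theorem isParity_not_even (d : ℕ) : IsParity fun x : Site d => ¬ Even (∑ i, x i) :=
  fun _ _ h => not_congr h.even_iff

/-- At a large activity no quasilocal specification is compatible with the two phases. -/
theorem not_exists_quasilocal {d : ℕ} (hd : 2 ≤ d) {p : unitInterval} (hp0 : 0 < p) (hp1 : p < 1)
    (ha : (8 * d ^ 2 * (64 * d + 1) : ℝ) ^ (8 * d) ≤ (p : ℝ) / (1 - p))
    (ha16 : 16 ≤ (p : ℝ) / (1 - p)) :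
    ¬ ∃ γ : Specification d, γ.IsSpecificationFor (thinnedField d p) ∧ γ.IsQuasilocal := by
  rintro ⟨γ, hγ, hq⟩
  obtain ⟨q, N, hqN⟩ := hq.exists_box hγ (cross d) (ε := 1 / 8) (by norm_num)
  set a : ℝ := (p : ℝ) / (1 - p)
  have ha0 : 0 < a := by linarith
  have key : ∀ P : Site d → Prop, IsParity P → cross d ⊆ phaseBox P (N + 2) ∧
      |(1 + a) * partition a ((phaseBox P (N + 2)).erase 0) -
          a * activeWeight a ((phaseBox P (N + 2)).erase 0) -
          q * ((1 + a) * partition a ((phaseBox P (N + 2)).erase 0))| ≤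
        1 / 8 * ((1 + a) * partition a ((phaseBox P (N + 2)).erase 0)) := by
    intro P hP
    have hcross : cross d ⊆ phaseBox P (N + 2) :=
      (cross_subset_box d N).trans (box_subset_phaseBox P)
    obtain ⟨S, B, κ, hS, hB, hVB, hκ, e1, e2⟩ := exists_conditioning hP hp0 hp1 (N + 2) hcross
    have := hqN S B hS hB fun x hx hx' =>
      hVB x (box_subset_phaseBox P (box_mono (Nat.le_succ N) hx)) hx'
    rw [e1, e2, mul_left_comm q, ← mul_sub, abs_mul, abs_of_pos hκ, mul_left_comm (1 / 8)] at this
    exact ⟨hcross, le_of_mul_le_mul_left this hκ⟩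
  have heven : Even (∑ i, (0 : Site d) i) := by simp
  obtain ⟨-, k1⟩ := key _ (isParity_even d)
  obtain ⟨hcross, k2⟩ := key _ (isParity_not_even d)
  have b1 := activeWeight_le hd (isParity_even d) (N + 2) heven ha ha0
  have b2 := le_activeWeight hd (isParity_not_even d) (N + 2) hcross (not_not.2 heven) ha ha16
  have z1 := partition_pos ha0 ((phaseBox (fun x : Site d => Even (∑ i, x i)) (N + 2)).erase 0)
  have z2 := partition_pos ha0 ((phaseBox (fun x : Site d => ¬ Even (∑ i, x i)) (N + 2)).erase 0)
  generalize partition a ((phaseBox (fun x : Site d => Even (∑ i, x i)) (N + 2)).erase 0) = Z₁ at *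
  generalize partition a ((phaseBox (fun x : Site d => ¬ Even (∑ i, x i)) (N + 2)).erase 0) = Z₂
    at *
  generalize activeWeight a ((phaseBox (fun x : Site d => Even (∑ i, x i)) (N + 2)).erase 0) = W₁
    at *
  generalize activeWeight a ((phaseBox (fun x : Site d => ¬ Even (∑ i, x i)) (N + 2)).erase 0) = W₂
    at *
  -- With tolerance `1/8`, the even phase gives `q ≥ 1 - 1/16 - 1/8`. In the odd phase `a / (1 + a)
  -- ≥ 1/2` gives `q ≤ 1 - 7/16 + 1/8 = 11/16`, which is below the `12/16` used.
  have u1 := (abs_le.1 k1).2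
  have u2 := (abs_le.1 k2).1
  have lower : 13 / 16 ≤ q := by
    have h1 : a * W₁ ≤ a * (1 / 16 * Z₁) := mul_le_mul_of_nonneg_left b1 ha0.le
    have h2 : 13 / 16 * ((1 + a) * Z₁) ≤ q * ((1 + a) * Z₁) := by nlinarith
    exact le_of_mul_le_mul_right h2 (by positivity)
  have upper : q ≤ 12 / 16 := by
    have h1 : a * (7 / 8 * Z₂) ≤ a * W₂ := mul_le_mul_of_nonneg_left b2 ha0.le
    have h3 : (1 + a) * Z₂ ≤ 2 * a * Z₂ := mul_le_mul_of_nonneg_right (by linarith) z2.le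
    have h2 : q * ((1 + a) * Z₂) ≤ 12 / 16 * ((1 + a) * Z₂) := by nlinarith
    exact le_of_mul_le_mul_right h2 (by positivity)
  linarith

theorem theorem1 (d : ℕ) (hd : 2 ≤ d) :
    ∃ pc : unitInterval, pc < 1 ∧ ∀ p : unitInterval, pc < p → p < 1 →
      ¬ ∃ γ : Specification d, γ.IsSpecificationFor (thinnedField d p) ∧ γ.IsQuasilocal := by
  set L : ℝ := (8 * d ^ 2 * (64 * d + 1) : ℝ) ^ (8 * d) with hL
  have hd' : (2 : ℝ) ≤ d := by exact_mod_cast hd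
  have hR : (16 : ℝ) ≤ 8 * d ^ 2 * (64 * d + 1) := by
    have h1 : (4 : ℝ) ≤ d ^ 2 := by nlinarith
    nlinarith
  have hL16 : 16 ≤ L := hR.trans (le_self_pow₀ (by linarith) (by omega))
  have hlt : L / (1 + L) < 1 := by rw [div_lt_one (by linarith)]; linarith
  -- The value of `p` at which the activity `p / (1 - p)` equals `L`.
  refine ⟨⟨L / (1 + L), div_nonneg (by linarith) (by linarith), hlt.le⟩, ?_, fun p hp hp1 => ?_⟩
  · exact Subtype.coe_lt_coe.1 hlt
  · have hp' : L / (1 + L) < (p : ℝ) := Subtype.coe_lt_coe.2 hp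
    have hp1' : (p : ℝ) < 1 := by exact_mod_cast hp1
    have hLa : L ≤ (p : ℝ) / (1 - p) := by
      rw [div_lt_iff₀ (by linarith)] at hp'
      rw [le_div_iff₀ (by linarith)]
      linarith
    have hp0 : 0 < p := lt_of_le_of_lt (unitInterval.nonneg _) hp
    exact not_exists_quasilocal hd hp0 hp1 hLa (hL16.trans hLa)
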